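/- For a graph $H$ with vertex set $[n]=\{1,\dots,n\}$ let $\langle H\rangle\in\{0,1\}^{n^2}$ be its adjacency matrix written row by row as a bit string; for a permutation $\pi\in S_n$ let $\pi(G)$ be the graph on $[n]$ with edges $\{\pi(u),\pi(v)\}$ for the edges $\{u,v\}$ of $G$; and let $\mathrm{Aut}(G)\le S_n$ be the automorphism group of $G$. All graphs are finite, simple and undirected. Lemma. There are an algorithm $D$ (a deterministic Turing machine), which takes as input a bit string $a$ and a natural number $p$ written in binary, outputs a bit string $D(a,p)$, and on every input runs in time polynomial in the length of $a$ plus the number of binary digits of $p$, and a constant $c$, such that for every $n\ge 0$ and every graph $G$ with vertex set $[n]$ there is a bit string $aux_G$, of length at most $c\,n^3\log n$ if $n\ge 2$, with the following property: for every permutation $\pi\in S_n$ there is a number $p_\pi\in\{1,\dots,n!/|\mathrm{Aut}(G)|\}$ such that $D(aux_G,p_\pi)=\langle \pi(G)\rangle$. -/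

import Mathlib

/-- The adjacency matrix of a graph on `n` labelled vertices, written row by row as a string of
`n * n` bits. -/
noncomputable def adjacencyString {n : ℕ} (G : SimpleGraph (Fin n)) : List Bool :=
  open Classical in
  (List.finRange n).flatMap fun i => (List.finRange n).map fun j => decide (G.Adj i j)

/-- `D` is computed by a polynomial-time Turing machine. The input is the pair of a bit string and
a number in binary; the running time is a polynomial in the length of that input, that is, in the
length of the string plus the number of binary digits of the number. -/
def IsPolyTimeDecoder (D : List Bool × ℕ → List Bool) : Prop :=
  Nonempty (Turing.TM2ComputableInPolyTime
    (Computability.encodingProd (Computability.encodingList Bool)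
      Computability.encodingNatBool).encode
    (Computability.encodingList Bool).encode D)

/-!
The strings `⟨π(G)⟩` correspond to the cosets of `Aut G`, that is, to the arrangements of the `n`
vertices in a list up to automorphisms of `G`. The decoder has to turn a number below
`N = n! / |Aut G|` into an arrangement so that every class of arrangements is hit.

**Arrangements from numbers.** Let a group `Γ` act on a set `S`, let `A` be the orbit of a point
`x`, and let `B` be the rest of `S`. Every arrangement can be moved by `Γ` so that `x` comes first
among the points of `A`. After that the stabilizer of `x` normalizes the arrangement of `A \ {x}`,
and the pointwise stabilizer of `A` normalizes that of `B`. So a representative of every class is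
obtained from representatives for `A \ {x}` and for `B` by merging two lists of lengths `a` and `b`,
in one of `(a + b).choose b` ways. By the orbit-stabilizer theorem the product of all these
binomial coefficients is at most `n! / |Γ|`. No group theory is left for the decoder to do: it only
has to select among the ways to merge, which the combinatorial number system does by comparisons
and subtractions. A single kind of comparator suffices: *if `w ≤ p`, subtract `w` from `p` and swap
two neighbouring entries*. Once one comparator of a loop has failed, the others fail by themselves,
because the weights `w` do not decrease. The digits of the mixed-radix number that belong to the
various merges are separated by multiplying the weights by constants. Altogether this takes `O(n²)`
comparators and moves (`exists_sortProgram`).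

**Matrices from arrangements.** The comparators are carried out on a list of rows of `n` bits. They
are applied to the rows of the adjacency matrix of `G`, then the matrix is transposed, and they are
applied again, starting from the same number `p`. Every comparator becomes `O(n log n)` instructions
of a straight-line program for a machine with a few stacks of bits, since `w` and `p` have
`O(n log n)` binary digits, and the transposition takes `O(n³)` instructions
(`Instr.run_sortMatrix`). So the program has length `O(n³ log n)`, and its code, reversed, is
the advice string.

**The decoder.** It is the interpreter of such programs. There are sixteen instructions, each with a
code of four bits and each executed by the Turing machine in a bounded number of steps, and no
jumps, so the running time is linear (`StackMachine.isPolyTimeDecoder_decoder`).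
-/

/-! ### Sorting programs -/

/-- A command of a sorting program. Such a program works on a number `p` and on a list with a
cursor. The commands `fwd` and `bwd` move the cursor by one entry. The comparator `cas w` tests
whether `w ≤ p`; if so, it subtracts `w` from `p` and swaps the two entries right of the cursor. -/
inductive SortCmd
  | fwd
  | bwd
  | cas (w : ℕ)

namespace SortCmd

variable {α : Type*}

/-- Swap the first two entries of a list, if there are two. -/
def swapHead : List α → List α
  | x :: y :: l => y :: x :: l
  | l => l

/-- The effect of one command on `(p, l, r)`: `p` is the current number, `l` the entries left of
the cursor, nearest first, and `r` the entries right of the cursor. -/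
def step : ℕ × List α × List α → SortCmd → ℕ × List α × List α
  | (p, l, x :: r), fwd => (p, x :: l, r)
  | (p, l, []), fwd => (p, l, [])
  | (p, x :: l, r), bwd => (p, l, x :: r)
  | (p, [], r), bwd => (p, [], r)
  | (p, l, r), cas w => if w ≤ p then (p - w, l, swapHead r) else (p, l, r)

/-- The effect of a sorting program. -/
def run (c : List SortCmd) (s : ℕ × List α × List α) : ℕ × List α × List α := c.foldl step s

/-- The number tested by a comparator; `0` for a move of the cursor. -/
def weight : SortCmd → ℕ
  | cas w => w
  | _ => 0

/-- Multiply the weight of a comparator by `m`. -/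
def scale (m : ℕ) : SortCmd → SortCmd
  | cas w => cas (w * m)
  | c => c

theorem weight_scale (m : ℕ) (c : SortCmd) : (c.scale m).weight = c.weight * m := by
  cases c <;> simp [scale, weight]

@[simp] theorem run_nil (s : ℕ × List α × List α) : run [] s = s := rfl

@[simp] theorem run_cons (c : SortCmd) (d : List SortCmd) (s : ℕ × List α × List α) :
    run (c :: d) s = run d (step s c) := rfl

@[simp] theorem run_append (c d : List SortCmd) (s : ℕ × List α × List α) :
    run (c ++ d) s = run d (run c s) := List.foldl_append

/-- Scaled programs act on the leading digit of a mixed-radix number. -/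
theorem run_scale {m r : ℕ} (hr : r < m) (c : List SortCmd) (q : ℕ) (l₁ l₂ : List α) :
    run (c.map (scale m)) (q * m + r, l₁, l₂) =
      ((run c (q, l₁, l₂)).1 * m + r, (run c (q, l₁, l₂)).2) := by
  induction c generalizing q l₁ l₂ with
  | nil => rfl
  | cons c d ih =>
    cases c with
    | fwd => cases l₂ <;> simp [scale, step, ih]
    | bwd => cases l₁ <;> simp [scale, step, ih]
    | cas w =>
      have key : w * m ≤ q * m + r ↔ w ≤ q := by
        constructor
        · intro h
          by_contra! hw
          have : (q + 1) * m ≤ w * m := Nat.mul_le_mul_right _ hw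
          rw [add_mul, one_mul] at this
          omega
        · intro h
          exact (Nat.mul_le_mul_right _ h).trans (Nat.le_add_right _ _)
      by_cases h : w ≤ q
      · have h' : q * m + r - w * m = (q - w) * m + r := by
          have := Nat.mul_le_mul_right m h
          rw [Nat.sub_mul]
          omega
        simp [scale, step, key, h, h', ih]
      · simp [scale, step, key, h, ih]

theorem run_replicate_fwd (p : ℕ) (u l r : List α) :
    run (List.replicate u.length fwd) (p, l, u ++ r) = (p, u.reverse ++ l, r) := by
  induction u generalizing l with
  | nil => rfl
  | cons x u ih => simp [List.replicate_succ, step, ih]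

theorem run_replicate_bwd (p : ℕ) (u l r : List α) :
    run (List.replicate u.length bwd) (p, u.reverse ++ l, r) = (p, l, u ++ r) := by
  induction u using List.reverseRecOn generalizing r with
  | nil => rfl
  | append_singleton u x ih => simp [List.replicate_succ, step, ih]

/-! ### Merging two lists -/

/-- Carry the entry right of the cursor to the right over at most `k` entries. It is the last of
`b + 1` entries that are to be merged into the list right of it, and it passes `j` entries when
`p` is at least `(j + b).choose (b + 1)`. -/
def carry (b : ℕ) : ℕ → List SortCmd
  | 0 => []
  | k + 1 => carry b k ++ [cas ((k + b).choose b), fwd]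

/-- Merge the `b` entries left of the cursor into the `a` entries right of it. The last of the `b`
entries is carried first. In the end the cursor is left of all `a + b` entries. -/
def merge (a : ℕ) : ℕ → List SortCmd
  | 0 => []
  | b + 1 => bwd :: carry b a ++ List.replicate a bwd ++ merge a b

theorem length_carry (b k : ℕ) : (carry b k).length = 2 * k := by
  induction k with
  | zero => rfl
  | succ k ih => simp [carry, ih]; ring

theorem length_merge (a b : ℕ) : (merge a b).length = b * (3 * a + 1) := by
  induction b with
  | zero => simp [merge]
  | succ b ih => simp [merge, ih, length_carry]; ring

theorem weight_carry_le {b k : ℕ} {c : SortCmd} (hc : c ∈ carry b k) :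
    c.weight ≤ (k + b).choose (b + 1) := by
  induction k with
  | zero => simp [carry] at hc
  | succ k ih =>
    have e : (k + 1 + b).choose (b + 1) = (k + b).choose b + (k + b).choose (b + 1) := by
      rw [show k + 1 + b = k + b + 1 by ring, Nat.choose_succ_succ]
    simp only [carry, List.mem_append, List.mem_cons, List.not_mem_nil, or_false] at hc
    rcases hc with hc | rfl | rfl
    · have := ih hc
      omega
    · simp only [weight]
      omega
    · simp [weight]

theorem weight_merge_le {a b : ℕ} {c : SortCmd} (hc : c ∈ merge a b) :
    c.weight ≤ (a + b).choose b := by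
  induction b with
  | zero => simp [merge] at hc
  | succ b ih =>
    have e : (a + (b + 1)).choose (b + 1) = (a + b).choose b + (a + b).choose (b + 1) := by
      rw [← add_assoc, Nat.choose_succ_succ]
    simp only [merge, List.mem_append, List.mem_cons, List.mem_replicate] at hc
    rcases hc with ((rfl | hc) | ⟨-, rfl⟩) | hc
    · simp [weight]
    · have := weight_carry_le hc
      omega
    · simp [weight]
    · have := ih hc
      omega

/-- The weights of the first `j` comparators of `carry` sum up to `(j + b).choose (b + 1)`, which is
the price for carrying an entry over `j` others. -/
theorem run_carry_pass (b p : ℕ) (x : α) (u l r : List α) :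
    run (carry b u.length) (p + (u.length + b).choose (b + 1), l, x :: u ++ r) =
      (p, u.reverse ++ l, x :: r) := by
  induction u using List.reverseRecOn generalizing p r with
  | nil => simp [carry]
  | append_singleton u y ih =>
    have e : p + (u.length + 1 + b).choose (b + 1) =
        (p + (u.length + b).choose b) + (u.length + b).choose (b + 1) := by
      rw [show u.length + 1 + b = u.length + b + 1 by ring, Nat.choose_succ_succ, add_assoc]
    have := ih (p + (u.length + b).choose b) (y :: r)
    simp only [List.cons_append] at this
    simp [carry, e, this, step, swapHead]

/-- Once a comparator of `carry` has failed, the remaining ones fail because their weights only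
grow. -/
theorem run_carry_stay {b k p : ℕ} {s : ℕ × List α × List α} {l r u : List α}
    (hs : run (carry b k) s = (p, l, u ++ r)) (hp : p < (k + b).choose b) :
    run (carry b (k + u.length)) s = (p, u.reverse ++ l, r) := by
  induction u using List.reverseRecOn generalizing r with
  | nil => simpa using hs
  | append_singleton u y ih =>
    have h1 := @ih (y :: r) (by simpa using hs)
    have h2 : ¬ (k + u.length + b).choose b ≤ p := by
      have : (k + b).choose b ≤ (k + u.length + b).choose b :=
        Nat.choose_le_choose b (by omega)
      omega
    simp [← add_assoc, carry, h1, step, h2]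

/-- Every shuffle `z` of two lists `x` and `y` is produced by merging, from a suitable number. The
entries `w` to the right of `y`, over which no entry of `x` is to be moved, stay in place. -/
theorem exists_run_merge (q : α → Bool) (x y z : List α) (hx : z.filter q = x)
    (hy : z.filter (fun v => !q v) = y) (a : ℕ) (hya : y.length ≤ a) :
    ∃ p < (y.length + x.length).choose x.length, ∀ l w : List α, a ≤ y.length + w.length →
      run (merge a x.length) (p, x.reverse ++ l, y ++ w) = (0, l, z ++ w) := by
  induction x using List.reverseRecOn generalizing y z with
  | nil =>
    refine ⟨0, by simp, fun l w _ => ?_⟩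
    have hz : z.filter (fun v => !q v) = z := by
      rw [List.filter_eq_nil_iff] at hx
      exact List.filter_eq_self.2 fun v hv => by simpa using hx v hv
    rw [hz] at hy
    simp [merge, hy]
  | append_singleton x v ih =>
    obtain ⟨z₁, z₂, rfl, h₁, h₂⟩ := List.filter_eq_append_iff.1 hx
    obtain ⟨z₃, z₄, rfl, h₃, h₄, h₅⟩ := List.filter_eq_cons_iff.1 h₂
    have h₃' : z₃.filter q = [] := List.filter_eq_nil_iff.2 h₃
    have hz₄ : z₄.filter (fun v => !q v) = z₄ := by
      rw [List.filter_eq_nil_iff] at h₅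
      exact List.filter_eq_self.2 fun v hv => by simpa using h₅ v hv
    set y₁ := (z₁ ++ z₃).filter (fun v => !q v) with hy₁
    have hy' : y = y₁ ++ z₄ := by
      rw [← hy, hy₁, ← List.append_assoc, List.filter_append]
      simp [h₄, hz₄]
    have hlen : y.length = y₁.length + z₄.length := by simp [hy']
    obtain ⟨p, hp, hrun⟩ := ih y₁ (z₁ ++ z₃) (by simp [h₁, h₃']) hy₁.symm (by omega)
    refine ⟨p + (y₁.length + x.length).choose (x.length + 1), ?_, fun l w haw => ?_⟩
    · have h6 : (y₁.length + x.length + 1).choose (x.length + 1) ≤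
          (y.length + (x.length + 1)).choose (x.length + 1) :=
        Nat.choose_le_choose _ (by omega)
      rw [Nat.choose_succ_succ'] at h6
      simp only [List.length_append, List.length_singleton]
      omega
    · have h7 := run_carry_pass x.length p v y₁ (x.reverse ++ l) (z₄ ++ w)
      -- the entries over which `v` is not carried, up to the end of the loop
      set u := (v :: (z₄ ++ w)).take (a - y₁.length) with hu
      have hul : u.length = a - y₁.length := by
        rw [hu, List.length_take]
        simp
        omega
      have h8 := run_carry_stay (u := u) (r := (v :: (z₄ ++ w)).drop (a - y₁.length))
        (by rw [h7, hu, List.take_append_drop]) hp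
      rw [hul, Nat.add_sub_cancel' (by omega)] at h8
      have h9 := run_replicate_bwd p (y₁ ++ u) (x.reverse ++ l)
        ((v :: (z₄ ++ w)).drop (a - y₁.length))
      have ha : (y₁ ++ u).length = a := by
        rw [List.length_append, hul]
        omega
      rw [ha, List.append_assoc y₁ u, hu, List.take_append_drop, ← hu] at h9
      have h10 : (x ++ [v]).reverse ++ l = v :: (x.reverse ++ l) := by simp
      have h11 : (x ++ [v]).length = x.length + 1 := by simp
      rw [h10, h11, merge, hy']
      simp only [List.cons_append, run_cons, run_append, step]
      rw [List.append_assoc, ← List.cons_append, h8, ← List.append_assoc, ← List.reverse_append,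
        h9]
      simpa using hrun l (v :: z₄ ++ w) (by simp; omega)

end SortCmd

/-! ### Sorting programs that reach every coset of a permutation group -/

section Cosets

open SortCmd Equiv

variable {V : Type*}

theorem card_eq_ncard_orbit_mul [Finite V] (Γ : Subgroup (Perm V)) (x : V) :
    Nat.card Γ = (MulAction.orbit Γ x).ncard *
      Nat.card (Γ ⊓ fixingSubgroup (Perm V) ({x} : Set V) : Subgroup (Perm V)) := by
  have h : Nat.card (MulAction.stabilizer Γ x) =
      Nat.card (Γ ⊓ fixingSubgroup (Perm V) ({x} : Set V) : Subgroup (Perm V)) := by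
    refine Nat.card_congr
      { toFun := fun g => ⟨g.1.1, g.1.2, ?_⟩
        invFun := fun g => ⟨⟨g.1, g.2.1⟩, ?_⟩
        left_inv := fun _ => rfl
        right_inv := fun _ => rfl }
    · refine (mem_fixingSubgroup_iff _).2 ?_
      rintro y rfl
      exact g.2
    · exact (mem_fixingSubgroup_iff _).1 g.2.2 x rfl
  rw [← h, ← MulAction.index_stabilizer, mul_comm, Subgroup.card_mul_index]

/-- For a group `Γ` of permutations acting on a set `S` of `m` points, there is a sorting program
of length `O(m²)` that turns one fixed arrangement of `S` into a representative of every
`Γ`-orbit of arrangements, as its number `p` ranges over at most `m! / [Γ : Γ_S]` values, where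
`Γ_S` is the pointwise stabilizer of `S`.

The proof is by induction on `m`. Split `S` into the orbit `A` of a point `x` and its complement
`B`. An arrangement can be moved within its `Γ`-orbit so that `x` comes first among the points of
`A`; then the stabilizer of `x` is used to normalize the arrangement of `A \ {x}`, and the pointwise
stabilizer of `A` to normalize that of `B`. It remains to merge the two arrangements. -/
theorem exists_sortProgram [Fintype V] [DecidableEq V] (S : Finset V) (Γ : Subgroup (Perm V))
    (hS : ∀ g ∈ Γ, ∀ v ∈ S, g v ∈ S) :
    ∃ (l₀ : List V) (c : List SortCmd) (N : ℕ), l₀.Nodup ∧ l₀.toFinset = S ∧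
      c.length ≤ 4 * S.card ^ 2 ∧ (∀ k ∈ c, k.weight ≤ N) ∧
      N * Nat.card Γ ≤ S.card.factorial *
        Nat.card (Γ ⊓ fixingSubgroup (Perm V) (S : Set V) : Subgroup (Perm V)) ∧
      ∀ l' : List V, l'.Nodup → l'.toFinset = S → ∃ g ∈ Γ, ∃ p < N, ∀ L R : List V,
        run c (p, L, l₀ ++ R) = (0, L, l'.map g ++ R) := by
  induction hm : S.card using Nat.strong_induction_on generalizing S Γ with
  | _ m ih =>
  rcases S.eq_empty_or_nonempty with rfl | ⟨x, hxS⟩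
  · refine ⟨[], [], 1, by simp, by simp, by simp, by simp, ?_, ?_⟩
    · rw [← hm]
      simp
    · intro l' _ hl'
      obtain rfl : l' = [] := by simpa using hl'
      exact ⟨1, one_mem _, 0, by simp, by simp⟩
  · classical
    -- the orbit of `x` and the two smaller instances
    set A : Finset V := Finset.univ.filter (· ∈ MulAction.orbit Γ x) with hA
    have hxA : x ∈ A := by simp [hA]
    have memA : ∀ v, v ∈ A ↔ ∃ g ∈ Γ, g x = v := by
      intro v
      simp only [hA, Finset.mem_filter, Finset.mem_univ, true_and, MulAction.mem_orbit_iff]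
      constructor
      · rintro ⟨g, rfl⟩
        exact ⟨g.1, g.2, rfl⟩
      · rintro ⟨g, hg, rfl⟩
        exact ⟨⟨g, hg⟩, rfl⟩
    have hAS : A ⊆ S := by
      intro v hv
      obtain ⟨g, hg, rfl⟩ := (memA v).1 hv
      exact hS g hg x hxS
    have hAinv : ∀ g ∈ Γ, ∀ v, g v ∈ A ↔ v ∈ A := by
      intro g hg v
      rw [memA, memA]
      constructor
      · rintro ⟨k, hk, hkv⟩
        exact ⟨g⁻¹ * k, mul_mem (inv_mem hg) hk, by simp [hkv]⟩
      · rintro ⟨k, hk, rfl⟩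
        exact ⟨g * k, mul_mem hg hk, rfl⟩
    set Γx : Subgroup (Perm V) := Γ ⊓ fixingSubgroup (Perm V) ({x} : Set V) with hΓx
    set K : Subgroup (Perm V) := Γ ⊓ fixingSubgroup (Perm V) (A : Set V) with hK
    have hfx : ∀ g ∈ Γx, g x = x := fun g hg =>
      (mem_fixingSubgroup_iff _).1 hg.2 x rfl
    have hfA : ∀ g ∈ K, ∀ v ∈ A, g v = v := fun g hg v hv =>
      (mem_fixingSubgroup_iff _).1 hg.2 v hv
    have cardA : (A.erase x).card + 1 = A.card := Finset.card_erase_add_one hxA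
    have cardAB : A.card + (S \ A).card = m := by
      rw [← hm, add_comm, Finset.card_sdiff_add_card_eq_card hAS]
    obtain ⟨lA, cA, NA, hlA, hlA', hcA, hwA, hNA, hrunA⟩ := ih (A.erase x).card (by omega)
      (A.erase x) Γx (fun g hg v hv => by
        rw [Finset.mem_erase] at hv ⊢
        refine ⟨fun h => hv.1 (g.injective (h.trans (hfx g hg).symm)), ?_⟩
        exact (hAinv g hg.1 v).2 hv.2) rfl
    obtain ⟨lB, cB, NB, hlB, hlB', hcB, hwB, hNB, hrunB⟩ := ih (S \ A).card (by omega)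
      (S \ A) K (fun g hg v hv => by
        rw [Finset.mem_sdiff] at hv ⊢
        exact ⟨hS g hg.1 v hv.1, fun h => hv.2 ((hAinv g hg.1 v).1 h)⟩) rfl
    have posA : 0 < NA := by
      obtain ⟨-, -, p, hp, -⟩ := hrunA lA hlA hlA'
      omega
    have posB : 0 < NB := by
      obtain ⟨-, -, p, hp, -⟩ := hrunB lB hlB hlB'
      omega
    have lenA : lA.length + 1 = A.card := by
      rw [← cardA, ← hlA', List.toFinset_card_of_nodup hlA]
    have lenB : lB.length = (S \ A).card := by
      rw [← hlB', List.toFinset_card_of_nodup hlB]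
    set a := A.card with ha
    set b := (S \ A).card with hb
    set C := (a + b).choose b with hC
    have posC : 0 < C := Nat.choose_pos (by omega)
    refine ⟨lB ++ x :: lA, cB.map (scale (NA * C)) ++ List.replicate (b + 1) fwd ++
      cA.map (scale C) ++ bwd :: merge a b, NB * (NA * C), ?_, ?_, ?_, ?_, ?_, ?_⟩
    · have hd : ∀ v ∈ lB, v ∉ A := fun v hv => by
        have : v ∈ S \ A := by rw [← hlB']; simpa using hv
        exact (Finset.mem_sdiff.1 this).2
      have hA' : ∀ v ∈ lA, v ≠ x ∧ v ∈ A := fun v hv => by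
        have : v ∈ A.erase x := by rw [← hlA']; simpa using hv
        exact Finset.mem_erase.1 this
      rw [List.nodup_append]
      refine ⟨hlB, List.nodup_cons.2 ⟨fun h => (hA' x h).1 rfl, hlA⟩, ?_⟩
      rintro v hv w hw rfl
      rcases List.mem_cons.1 hw with rfl | hw
      · exact hd _ hv hxA
      · exact hd _ hv (hA' _ hw).2
    · rw [List.toFinset_append, List.toFinset_cons, hlA', hlB', Finset.insert_erase hxA,
        Finset.sdiff_union_of_subset hAS]
    · simp only [List.length_append, List.length_map, List.length_replicate, List.length_cons,
        length_merge]
      have e1 : (A.erase x).card = a - 1 := by omega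
      rw [e1] at hcA
      obtain ⟨a', ha'⟩ : ∃ a', a = a' + 1 := ⟨a - 1, by omega⟩
      rw [ha', Nat.add_sub_cancel] at hcA
      rw [← cardAB, ha']
      nlinarith [Nat.zero_le (a' * b)]
    · intro k hk
      simp only [List.mem_append, List.mem_map, List.mem_replicate, List.mem_cons] at hk
      rcases hk with ((⟨k, hk, rfl⟩ | ⟨-, rfl⟩) | ⟨k, hk, rfl⟩) | rfl | hk
      · rw [weight_scale]
        exact Nat.mul_le_mul_right _ (hwB k hk)
      · simp [weight]
      · rw [weight_scale]
        exact (Nat.mul_le_mul_right _ (hwA k hk)).trans (Nat.le_mul_of_pos_left _ posB)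
      · simp [weight]
      · calc k.weight ≤ C := weight_merge_le hk
          _ ≤ NA * C := Nat.le_mul_of_pos_left _ posA
          _ ≤ NB * (NA * C) := Nat.le_mul_of_pos_left _ posB
    · have e1 : Γx ⊓ fixingSubgroup (Perm V) ((A.erase x : Finset V) : Set V) = K := by
        rw [hΓx, hK, inf_assoc, ← fixingSubgroup_union]
        congr 2
        ext v
        by_cases hv : v = x <;> simp [hv, hxA]
      have e2 : K ⊓ fixingSubgroup (Perm V) ((S \ A : Finset V) : Set V) =
          Γ ⊓ fixingSubgroup (Perm V) (S : Set V) := by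
        rw [hK, inf_assoc, ← fixingSubgroup_union]
        congr 2
        rw [← Finset.coe_union, Finset.union_sdiff_of_subset hAS]
      have e3 : Nat.card Γ = a * Nat.card Γx := by
        rw [card_eq_ncard_orbit_mul Γ x, ← hΓx, ha]
        congr 1
        rw [← Set.ncard_coe_finset]
        congr 1
        ext v
        simp [hA]
      rw [e1] at hNA
      rw [e2] at hNB
      have e4 : a.factorial = a * (A.erase x).card.factorial := by
        rw [← cardA, Nat.factorial_succ]
      have e5 : C * a.factorial * b.factorial = m.factorial := by
        rw [hC, ← cardAB, Nat.add_choose_mul_factorial_mul_factorial]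
      calc NB * (NA * C) * Nat.card Γ = NB * C * a * (NA * Nat.card Γx) := by rw [e3]; ring
        _ ≤ NB * C * a * ((A.erase x).card.factorial * Nat.card K) := Nat.mul_le_mul_left _ hNA
        _ = C * a.factorial * (NB * Nat.card K) := by rw [e4]; ring
        _ ≤ C * a.factorial * (b.factorial * _) := Nat.mul_le_mul_left _ hNB
        _ = _ := by rw [← mul_assoc, e5]
    · intro l' hl' hl'S
      set q : V → Bool := fun v => decide (v ∉ A) with hq
      have hqA : ∀ v, (!q v) = decide (v ∈ A) := by simp [hq]
      -- `x` is moved to the front of the points of `A`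
      obtain ⟨y, yt, hy⟩ : ∃ y yt, l'.filter (fun v => !q v) = y :: yt := by
        apply List.exists_cons_of_ne_nil
        intro h
        rw [List.filter_eq_nil_iff] at h
        have hx : x ∈ l' := by rw [← List.mem_toFinset, hl'S]; exact hxS
        have := h x hx
        simp [hqA, hxA] at this
      have hyA : y ∈ A := by
        have : y ∈ l'.filter (fun v => !q v) := by simp [hy]
        simpa [hqA] using (List.mem_filter.1 this).2
      obtain ⟨g₀', hg₀', hg₀y⟩ := (memA y).1 hyA
      set g₀ := g₀'⁻¹ with hg₀
      have hg₀Γ : g₀ ∈ Γ := inv_mem hg₀'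
      have hg₀x : g₀ y = x := by rw [hg₀, ← hg₀y]; simp
      have filt : ∀ g ∈ Γ, ∀ l : List V, (l.map g).filter (fun v => !q v) =
          (l.filter (fun v => !q v)).map g := by
        intro g hg l
        rw [List.filter_map]
        congr 2
        ext v
        simp [hqA, hAinv g hg v]
      have filt' : ∀ g ∈ Γ, ∀ l : List V, (l.map g).filter q = (l.filter q).map g := by
        intro g hg l
        rw [List.filter_map]
        congr 2
        ext v
        simp [hq, hAinv g hg v]
      have nd : (y :: yt).Nodup := hy ▸ hl'.filter _
      have mem_yt : ∀ v, v ∈ y :: yt ↔ v ∈ A := by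
        intro v
        rw [← hy, List.mem_filter, hqA, ← List.mem_toFinset, hl'S]
        simpa using @hAS v
      obtain ⟨g₁, hg₁, pA, hpA, hrA⟩ := hrunA (yt.map g₀)
        ((List.nodup_cons.1 nd).2.map g₀.injective) (by
          ext v
          rw [List.mem_toFinset, List.mem_map, Finset.mem_erase]
          constructor
          · rintro ⟨w, hw, rfl⟩
            refine ⟨fun h => ?_, (hAinv g₀ hg₀Γ w).2 ((mem_yt w).1 (List.mem_cons_of_mem _ hw))⟩
            have := g₀.injective (h.trans hg₀x.symm)
            exact (List.nodup_cons.1 nd).1 (this ▸ hw)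
          · rintro ⟨hvx, hvA⟩
            have h1 : g₀⁻¹ v ∈ y :: yt := by
              rw [mem_yt, ← hAinv g₀ hg₀Γ]
              simpa using hvA
            rcases List.mem_cons.1 h1 with h1 | h1
            · exact absurd (by rw [← hg₀x, ← h1]; simp) hvx
            · exact ⟨_, h1, by simp⟩)
      set l₂ := (l'.map g₀).map g₁ with hl₂
      have hl₂A : l₂.filter (fun v => !q v) = x :: (yt.map g₀).map g₁ := by
        rw [hl₂, filt g₁ hg₁.1, filt g₀ hg₀Γ, hy]
        simp [hg₀x, hfx g₁ hg₁]
      have hl₂S : l₂.toFinset = S := by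
        ext v
        rw [List.mem_toFinset, hl₂, List.map_map, List.mem_map]
        have hmem : g₁ * g₀ ∈ Γ := mul_mem hg₁.1 hg₀Γ
        constructor
        · rintro ⟨w, hw, rfl⟩
          exact hS _ hmem w (by rw [← hl'S]; simpa using hw)
        · intro hv
          refine ⟨(g₁ * g₀)⁻¹ v, ?_, ?_⟩
          · rw [← List.mem_toFinset, hl'S]
            exact hS _ (inv_mem hmem) v hv
          · exact (g₁ * g₀).apply_symm_apply v
      have nd₂ : l₂.Nodup := (hl'.map g₀.injective).map g₁.injective
      obtain ⟨g₂, hg₂, pB, hpB, hrB⟩ := hrunB (l₂.filter q) (nd₂.filter _) (by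
        ext v
        rw [List.toFinset_filter, hl₂S]
        simp [hq])
      set l₃ := l₂.map g₂ with hl₃
      have hl₃A : l₃.filter (fun v => !q v) = x :: (yt.map g₀).map g₁ := by
        rw [hl₃, filt g₂ hg₂.1]
        conv_rhs => rw [← hl₂A]
        conv_rhs => rw [← List.map_id (l₂.filter _)]
        refine List.map_congr_left fun v hv => hfA g₂ hg₂ v ?_
        simpa [hqA] using (List.mem_filter.1 hv).2
      have hl₃B : l₃.filter q = (l₂.filter q).map g₂ := filt' g₂ hg₂.1 l₂
      have lenyt : yt.length + 1 = a := by
        rw [← List.length_cons (a := y), ← List.toFinset_card_of_nodup nd]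
        congr 1
        ext v
        rw [List.mem_toFinset, mem_yt]
      have lenX : (l₃.filter q).length = b := by
        have h1 := hrB [] []
        have h2 : (l₂.filter q).toFinset = S \ A := by
          ext v
          rw [List.toFinset_filter, hl₂S]
          simp [hq]
        rw [hl₃B, List.length_map, ← List.toFinset_card_of_nodup (nd₂.filter _), h2]
      refine ⟨g₂ * (g₁ * g₀), mul_mem hg₂.1 (mul_mem hg₁.1 hg₀Γ), ?_⟩
      obtain ⟨pM, hpM, hrM⟩ := exists_run_merge q _ _ l₃ rfl hl₃A a (by simp; omega)
      have hpM' : pM < C := by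
        convert hpM using 2
        · simp
          omega
        · exact lenX.symm
      have hpAC : pA * C + pM < NA * C := by
        have : (pA + 1) * C ≤ NA * C := Nat.mul_le_mul_right _ hpA
        rw [add_mul, one_mul] at this
        omega
      refine ⟨pB * (NA * C) + (pA * C + pM), ?_, fun L R => ?_⟩
      · have : (pB + 1) * (NA * C) ≤ NB * (NA * C) := Nat.mul_le_mul_right _ hpB
        rw [add_mul, one_mul] at this
        omega
      · have hmap : l'.map (g₂ * (g₁ * g₀) : Perm V) = l₃ := by
          rw [hl₃, hl₂, List.map_map, List.map_map]
          rfl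
        have r1 := run_scale hpAC cB pB L (lB ++ x :: (lA ++ R))
        rw [hrB] at r1
        have r2 := run_replicate_fwd (pA * C + pM) ((l₃.filter q) ++ [x]) L (lA ++ R)
        have r3 := run_scale hpM' cA pA (x :: (l₃.filter q).reverse ++ L) (lA ++ R)
        rw [hrA] at r3
        have r4 := hrM L R (by simp; omega)
        have hlen : ((l₃.filter q) ++ [x]).length = b + 1 := by simp [lenX]
        rw [hlen] at r2
        simp only [List.append_assoc, List.cons_append, List.nil_append, zero_mul, zero_add,
          List.reverse_append, List.reverse_cons, List.reverse_nil, lenX] at r1 r2 r3 r4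
        simp only [List.append_assoc, List.cons_append, run_append, r1, run_cons, hmap, ← hl₃B,
          r2, r3, step, r4]

end Cosets

/-! ### Binary numbers with the least significant bit first -/

/-- The number with the given binary digits, least significant digit first. Leading zeros are
allowed. -/
def bitsVal : List Bool → ℕ
  | [] => 0
  | b :: l => b.toNat + 2 * bitsVal l

/-- The `k` lowest binary digits of `w`, least significant digit first. -/
def toBits : ℕ → ℕ → List Bool
  | 0, _ => []
  | k + 1, w => w.bodd :: toBits k w.div2

@[simp] theorem length_toBits (k w : ℕ) : (toBits k w).length = k := by
  induction k generalizing w with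
  | zero => rfl
  | succ k ih => simp [toBits, ih]

theorem bitsVal_toBits {k w : ℕ} (h : w < 2 ^ k) : bitsVal (toBits k w) = w := by
  induction k generalizing w with
  | zero => simp [toBits, bitsVal]; omega
  | succ k ih =>
    have h2 := Nat.bodd_add_div2 w
    rw [toBits, bitsVal, ih (by rw [pow_succ] at h; omega), h2]

theorem bitsVal_append (l m : List Bool) :
    bitsVal (l ++ m) = bitsVal l + 2 ^ l.length * bitsVal m := by
  induction l with
  | nil => simp [bitsVal]
  | cons b l ih => simp only [List.cons_append, bitsVal, ih, List.length_cons, pow_succ]; ring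

theorem bitsVal_lt (l : List Bool) : bitsVal l < 2 ^ l.length := by
  induction l with
  | nil => simp [bitsVal]
  | cons b l ih =>
    have := b.toNat_lt
    simp only [bitsVal, List.length_cons, pow_succ]
    omega

theorem bitsVal_encodeNat (p : ℕ) : bitsVal (Computability.encodeNat p) = p := by
  have key : ∀ m : PosNum, bitsVal (Computability.encodePosNum m) = (m : ℕ) := by
    intro m
    induction m with
    | one => rfl
    | bit0 m ih => simp [Computability.encodePosNum, bitsVal, ih]; ring
    | bit1 m ih => simp [Computability.encodePosNum, bitsVal, ih]; ring
  have key' : ∀ m : Num, bitsVal (Computability.encodeNum m) = (m : ℕ) := by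
    intro m
    cases m with
    | zero => rfl
    | pos m => exact key m
  rw [Computability.encodeNat, key', Num.to_of_nat]

theorem length_encodeNat_le {p k : ℕ} (h : p < 2 ^ k) :
    (Computability.encodeNat p).length ≤ k := by
  have key : ∀ m : PosNum, 2 ^ (Computability.encodePosNum m).length ≤ 2 * (m : ℕ) := by
    intro m
    induction m with
    | one => simp [Computability.encodePosNum]
    | bit0 m ih => simp [Computability.encodePosNum, pow_succ]; omega
    | bit1 m ih => simp [Computability.encodePosNum, pow_succ]; omega
  have key' : ∀ m : Num, (m : ℕ) < 2 ^ k → (Computability.encodeNum m).length ≤ k := by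
    intro m hm
    cases m with
    | zero => simp [Computability.encodeNum]
    | pos m =>
      rw [Computability.encodeNum]
      have h1 := key m
      rw [Num.cast_pos] at hm
      have h2 : 2 ^ (Computability.encodePosNum m).length < 2 ^ (k + 1) := by
        rw [pow_succ]
        omega
      have := (Nat.pow_lt_pow_iff_right (by norm_num)).1 h2
      omega
  exact key' _ (by rwa [Num.to_of_nat])

/-! ### Straight-line stack programs -/

/-- The memory of the stack machine: a flag and six stacks of bits. `P` holds the input number,
`Q` the number being worked on, least significant bit on top. `L` and `R` hold the bits left and
right of a cursor. `A` and `B` are scratch space. -/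
@[ext]
structure Memory where
  flag : Bool
  P : List Bool
  Q : List Bool
  A : List Bool
  B : List Bool
  L : List Bool
  R : List Bool

/-- The instructions of the stack machine. -/
inductive Instr
  /-- Push a bit to `R`. -/
  | push (b : Bool)
  /-- Move a bit from `R` to `L`. -/
  | toLeft
  /-- Move a bit from `L` to `R`. -/
  | toRight
  /-- Move a bit from `R` to `A`. -/
  | toA
  /-- Move a bit from `R` to `B`. -/
  | toB
  /-- Move a bit to `R`, from `B` if the flag equals `c`, otherwise from `A`. -/
  | restore (c : Bool)
  /-- Move a bit from `R` to `L` and push a copy of it to `A`. -/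
  | copy
  /-- Remove a bit from `R`. -/
  | drop
  /-- Reset the flag. -/
  | clear
  /-- One digit of a subtraction: remove a digit `x` from `Q`, where an empty stack counts as `0`,
  push `x` to `A` and the digit of `x - b` to `B`. The flag is the borrow. -/
  | sub (b : Bool)
  /-- Remove a bit from `A` and from `B`, and push the former to `Q` if the flag is set and the
  latter otherwise. -/
  | select
  /-- Remove a bit from `P` and push it to `Q` and to `A`. -/
  | load
  /-- Move a bit from `A` to `P`. -/
  | reload
  deriving Fintype

namespace Instr

/-- The effect of an instruction. Moving a bit from an empty stack does nothing. -/
def exec : Memory → Instr → Memory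
  | ⟨f, P, Q, A, B, L, R⟩, push b => ⟨f, P, Q, A, B, L, b :: R⟩
  | ⟨f, P, Q, A, B, L, R⟩, toLeft => ⟨f, P, Q, A, B, R.head?.toList ++ L, R.tail⟩
  | ⟨f, P, Q, A, B, L, R⟩, toRight => ⟨f, P, Q, A, B, L.tail, L.head?.toList ++ R⟩
  | ⟨f, P, Q, A, B, L, R⟩, toA => ⟨f, P, Q, R.head?.toList ++ A, B, L, R.tail⟩
  | ⟨f, P, Q, A, B, L, R⟩, toB => ⟨f, P, Q, A, R.head?.toList ++ B, L, R.tail⟩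
  | ⟨f, P, Q, A, B, L, R⟩, restore c =>
    if f = c then ⟨f, P, Q, A, B.tail, L, B.head?.toList ++ R⟩
    else ⟨f, P, Q, A.tail, B, L, A.head?.toList ++ R⟩
  | ⟨f, P, Q, A, B, L, R⟩, copy =>
    ⟨f, P, Q, R.head?.toList ++ A, B, R.head?.toList ++ L, R.tail⟩
  | ⟨f, P, Q, A, B, L, R⟩, drop => ⟨f, P, Q, A, B, L, R.tail⟩
  | ⟨_, P, Q, A, B, L, R⟩, clear => ⟨false, P, Q, A, B, L, R⟩
  | ⟨f, P, Q, A, B, L, R⟩, sub b =>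
    ⟨Bool.carry (!Q.headD false) b f, P, Q.tail, Q.headD false :: A,
      (Q.headD false ^^ (b ^^ f)) :: B, L, R⟩
  | ⟨f, P, Q, A, B, L, R⟩, select =>
    ⟨f, P, (if f then A.headD false else B.headD false) :: Q, A.tail, B.tail, L, R⟩
  | ⟨f, P, Q, A, B, L, R⟩, load =>
    ⟨f, P.tail, P.head?.toList ++ Q, P.head?.toList ++ A, B, L, R⟩
  | ⟨f, P, Q, A, B, L, R⟩, reload => ⟨f, A.head?.toList ++ P, Q, A.tail, B, L, R⟩

/-- The effect of a straight-line program. -/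
def run (c : List Instr) (s : Memory) : Memory := c.foldl exec s

@[simp] theorem run_nil (s : Memory) : run [] s = s := rfl

@[simp] theorem run_cons (i : Instr) (c : List Instr) (s : Memory) :
    run (i :: c) s = run c (exec s i) := rfl

@[simp] theorem run_append (c d : List Instr) (s : Memory) :
    run (c ++ d) s = run d (run c s) := List.foldl_append

theorem run_replicate_of_exec_eq {i : Instr} {s : Memory} (h : exec s i = s) (k : ℕ) :
    run (List.replicate k i) s = s := by
  induction k with
  | zero => rfl
  | succ k ih => rw [List.replicate_succ, run_cons, h, ih]

section Moves

variable (f : Bool) (P Q A B L R u : List Bool)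

theorem run_push : run (u.reverse.map push) ⟨f, P, Q, A, B, L, R⟩ =
    ⟨f, P, Q, A, B, L, u ++ R⟩ := by
  induction u with
  | nil => rfl
  | cons x u ih => rw [List.reverse_cons, List.map_append, run_append, ih]; rfl

theorem run_toLeft : run (List.replicate u.length toLeft) ⟨f, P, Q, A, B, L, u ++ R⟩ =
    ⟨f, P, Q, A, B, u.reverse ++ L, R⟩ := by
  induction u generalizing L with
  | nil => rfl
  | cons x u ih => simp [List.replicate_succ, exec, ih]

theorem run_toRight : run (List.replicate u.length toRight) ⟨f, P, Q, A, B, u ++ L, R⟩ =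
    ⟨f, P, Q, A, B, L, u.reverse ++ R⟩ := by
  induction u generalizing R with
  | nil => rfl
  | cons x u ih => simp [List.replicate_succ, exec, ih]

theorem run_toA : run (List.replicate u.length toA) ⟨f, P, Q, A, B, L, u ++ R⟩ =
    ⟨f, P, Q, u.reverse ++ A, B, L, R⟩ := by
  induction u generalizing A with
  | nil => rfl
  | cons x u ih => simp [List.replicate_succ, exec, ih]

theorem run_toB : run (List.replicate u.length toB) ⟨f, P, Q, A, B, L, u ++ R⟩ =
    ⟨f, P, Q, A, u.reverse ++ B, L, R⟩ := by
  induction u generalizing B with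
  | nil => rfl
  | cons x u ih => simp [List.replicate_succ, exec, ih]

theorem run_restore_eq : run (List.replicate u.length (restore f)) ⟨f, P, Q, A, u ++ B, L, R⟩ =
    ⟨f, P, Q, A, B, L, u.reverse ++ R⟩ := by
  induction u generalizing R with
  | nil => rfl
  | cons x u ih => simp [List.replicate_succ, exec, ih]

theorem run_restore_not :
    run (List.replicate u.length (restore !f)) ⟨f, P, Q, u ++ A, B, L, R⟩ =
      ⟨f, P, Q, A, B, L, u.reverse ++ R⟩ := by
  induction u generalizing R with
  | nil => rfl
  | cons x u ih => simp [List.replicate_succ, exec, ih]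

theorem run_drop : run (List.replicate u.length drop) ⟨f, P, Q, A, B, L, u ++ R⟩ =
    ⟨f, P, Q, A, B, L, R⟩ := by
  induction u with
  | nil => rfl
  | cons x u ih => simp [List.replicate_succ, exec, ih]

theorem run_load : run (List.replicate u.length load) ⟨f, u ++ P, Q, A, B, L, R⟩ =
    ⟨f, P, u.reverse ++ Q, u.reverse ++ A, B, L, R⟩ := by
  induction u generalizing Q A with
  | nil => rfl
  | cons x u ih => simp [List.replicate_succ, exec, ih]

theorem run_reload : run (List.replicate u.length reload) ⟨f, P, Q, u ++ A, B, L, R⟩ =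
    ⟨f, u.reverse ++ P, Q, A, B, L, R⟩ := by
  induction u generalizing P with
  | nil => rfl
  | cons x u ih => simp [List.replicate_succ, exec, ih]

end Moves

/-! ### Comparing and subtracting -/

/-- Subtract the `k`-digit number `w` from the number on `Q` if it is not larger than that number.
The flag tells whether it is larger. -/
def subtract (k w : ℕ) : List Instr :=
  clear :: (toBits k w).map sub ++ List.replicate k select

/-- After the digits of `w` have been subtracted, `A` holds the digits `xs` removed from `Q`, `B`
holds the digits `ds` of the difference modulo a power of two, and the flag is the last borrow. -/
theorem run_sub (f : Bool) (P Q A B L R ws : List Bool) :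
    ∃ (g : Bool) (xs ds : List Bool), xs.length = ws.length ∧ ds.length = ws.length ∧
      run (ws.map sub) ⟨f, P, Q, A, B, L, R⟩ =
        ⟨g, P, Q.drop ws.length, xs.reverse ++ A, ds.reverse ++ B, L, R⟩ ∧
      bitsVal Q = bitsVal xs + 2 ^ ws.length * bitsVal (Q.drop ws.length) ∧
      bitsVal xs + 2 ^ ws.length * g.toNat = bitsVal ds + bitsVal ws + f.toNat := by
  induction ws generalizing f Q A B with
  | nil => exact ⟨f, [], [], by simp [bitsVal]⟩
  | cons w ws ih =>
    set x := Q.headD false with hx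
    obtain ⟨g, xs, ds, h1, h2, h3, h4, h5⟩ :=
      ih (Bool.carry (!x) w f) Q.tail (x :: A) ((x ^^ (w ^^ f)) :: B)
    have hQ : bitsVal Q = x.toNat + 2 * bitsVal Q.tail := by
      cases Q <;> simp [bitsVal, hx]
    refine ⟨g, x :: xs, (x ^^ (w ^^ f)) :: ds, by simp [h1], by simp [h2], ?_, ?_, ?_⟩
    · rw [List.map_cons, run_cons, exec, ← hx, h3]
      simp
    · rw [hQ, h4]
      simp only [bitsVal, List.length_cons, pow_succ, List.drop_tail]
      ring
    · have h6 : x.toNat + 2 * (Bool.carry (!x) w f).toNat =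
          (x ^^ (w ^^ f)).toNat + w.toNat + f.toNat := by
        cases x <;> cases w <;> cases f <;> rfl
      simp only [bitsVal, List.length_cons, pow_succ]
      have : 2 ^ ws.length * 2 * g.toNat = 2 * (2 ^ ws.length * g.toNat) := by ring
      omega

theorem run_select (f : Bool) (P Q A B L R xs ds : List Bool) (h : xs.length = ds.length) :
    run (List.replicate xs.length select) ⟨f, P, Q, xs ++ A, ds ++ B, L, R⟩ =
      ⟨f, P, (if f then xs else ds).reverse ++ Q, A, B, L, R⟩ := by
  induction xs generalizing ds Q with
  | nil =>
    obtain rfl : ds = [] := by simpa using h.symm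
    simp
  | cons x xs ih =>
    obtain - | ⟨d, ds⟩ := ds
    · simp at h
    · cases f <;> simp [List.replicate_succ, exec, ih _ ds (by simpa using h)]

theorem run_subtract {k w : ℕ} (hw : w < 2 ^ k) (f : Bool) (P Q A B L R : List Bool)
    (hQ : bitsVal Q < 2 ^ k) :
    ∃ Q', run (subtract k w) ⟨f, P, Q, A, B, L, R⟩ =
        ⟨decide (bitsVal Q < w), P, Q', A, B, L, R⟩ ∧
      bitsVal Q' = if w ≤ bitsVal Q then bitsVal Q - w else bitsVal Q := by
  obtain ⟨g, xs, ds, h1, h2, h3, h4, h5⟩ := run_sub false P Q A B L R (toBits k w)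
  rw [length_toBits] at h1 h2 h3 h4 h5
  rw [bitsVal_toBits hw] at h5
  have hz : bitsVal (Q.drop k) = 0 := by
    by_contra h
    have : 2 ^ k * 1 ≤ 2 ^ k * bitsVal (Q.drop k) :=
      Nat.mul_le_mul_left _ (Nat.one_le_iff_ne_zero.2 h)
    omega
  have hds : bitsVal ds < 2 ^ k := h2 ▸ bitsVal_lt ds
  rw [hz, mul_zero, add_zero] at h4
  have hg : g = decide (bitsVal Q < w) := by
    cases g with
    | false =>
      simp only [Bool.toNat_false] at h5
      symm
      rw [decide_eq_false_iff_not]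
      omega
    | true =>
      simp only [Bool.toNat_false, Bool.toNat_true] at h5
      symm
      rw [decide_eq_true_iff]
      omega
  have h6 := run_select g P (Q.drop k) A B L R xs.reverse ds.reverse (by simp [h1, h2])
  rw [List.length_reverse, h1] at h6
  refine ⟨(if g then xs else ds) ++ Q.drop k, ?_, ?_⟩
  · simp only [subtract, List.cons_append, run_cons, run_append, exec, h3, h6, ← hg]
    cases g <;> simp
  · rw [bitsVal_append, hz, mul_zero, add_zero]
    cases g with
    | false =>
      simp only [Bool.toNat_false] at h5
      have h7 : w ≤ bitsVal Q := by omega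
      simp only [Bool.false_eq_true, if_false, if_pos h7]
      omega
    | true =>
      have h7 : ¬ w ≤ bitsVal Q := by simpa using hg.symm
      rw [if_pos rfl, if_neg h7, h4]

end Instr

/-! ### Sorting the rows of a matrix -/

namespace Instr

variable {α : Type*}

/-- Swap the first two blocks of `n` bits on `R`, unless the flag is set. -/
def swapRows (n : ℕ) : List Instr :=
  List.replicate n toA ++ List.replicate n toB ++
    List.replicate n (restore true) ++ List.replicate n (restore false)

/-- The stack program for a command of a sorting program, for rows of `n` bits and numbers of
`k` bits. -/
def ofSortCmd (n k : ℕ) : SortCmd → List Instr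
  | .fwd => List.replicate n toLeft
  | .bwd => List.replicate n toRight
  | .cas w => subtract k w ++ swapRows n

theorem run_swapRows {n : ℕ} {r : α → List Bool} (hr : ∀ v, (r v).length = n) (f : Bool)
    (P Q L : List Bool) (l : List α) :
    run (swapRows n) ⟨f, P, Q, [], [], L, l.flatMap r⟩ =
      ⟨f, P, Q, [], [], L, (if f then l else SortCmd.swapHead l).flatMap r⟩ := by
  match l with
  | [] =>
    have h1 : run (List.replicate n toA) ⟨f, P, Q, [], [], L, []⟩ = ⟨f, P, Q, [], [], L, []⟩ :=
      run_replicate_of_exec_eq rfl n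
    have h2 : run (List.replicate n toB) ⟨f, P, Q, [], [], L, []⟩ = ⟨f, P, Q, [], [], L, []⟩ :=
      run_replicate_of_exec_eq rfl n
    have h3 : ∀ c, run (List.replicate n (restore c)) ⟨f, P, Q, [], [], L, []⟩ =
        ⟨f, P, Q, [], [], L, []⟩ := fun c =>
      run_replicate_of_exec_eq (by simp [exec]) n
    cases f <;> simp [swapRows, h1, h2, h3, SortCmd.swapHead]
  | [x] =>
    have h1 := run_toA f P Q [] [] L [] (r x)
    have h2 : run (List.replicate n toB) ⟨f, P, Q, (r x).reverse, [], L, []⟩ =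
        ⟨f, P, Q, (r x).reverse, [], L, []⟩ := run_replicate_of_exec_eq rfl n
    have h3 := run_restore_not f P Q [] [] L [] (r x).reverse
    have h4 : ∀ A R, run (List.replicate n (restore f)) ⟨f, P, Q, A, [], L, R⟩ =
        ⟨f, P, Q, A, [], L, R⟩ := fun A R =>
      run_replicate_of_exec_eq (by simp [exec]) n
    rw [List.length_reverse] at h3
    rw [hr] at h1 h3
    simp only [List.append_nil, List.reverse_reverse] at h1 h3
    cases f <;> simp only [Bool.not_false, Bool.not_true] at h3 <;>
      simp [swapRows, h1, h2, h3, h4, SortCmd.swapHead]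
  | x :: y :: l =>
    have h1 := run_toA f P Q [] [] L (r y ++ l.flatMap r) (r x)
    have h2 := run_toB f P Q (r x).reverse [] L (l.flatMap r) (r y)
    have h3 := run_restore_not f P Q [] (r y).reverse L (l.flatMap r) (r x).reverse
    have h4 := run_restore_eq f P Q [] [] L (r x ++ l.flatMap r) (r y).reverse
    have h5 := run_restore_eq f P Q (r x).reverse [] L (l.flatMap r) (r y).reverse
    have h6 := run_restore_not f P Q [] [] L (r y ++ l.flatMap r) (r x).reverse
    rw [List.length_reverse] at h3 h4 h5 h6
    rw [hr] at h1 h2 h3 h4 h5 h6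
    simp only [List.append_nil, List.reverse_reverse] at h1 h2 h3 h4 h5 h6
    cases f with
    | false => simp [swapRows, h1, h2, Bool.not_false ▸ h3, h4, SortCmd.swapHead]
    | true => simp [swapRows, h1, h2, h5, Bool.not_true ▸ h6]

/-- The memory `s` represents the state `(p, l, l')` of a sorting program: `Q` holds `p`, and the
rows of the entries left and right of the cursor are on `L` and `R`. The input number on `P` is
intact and the scratch space is empty. -/
def Represents (r : α → List Bool) (P : List Bool) (z : ℕ × List α × List α) (s : Memory) : Prop :=
  s.P = P ∧ bitsVal s.Q = z.1 ∧ s.A = [] ∧ s.B = [] ∧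
    s.L = z.2.1.flatMap (fun v => (r v).reverse) ∧ s.R = z.2.2.flatMap r

theorem represents_run_ofSortCmd {n k : ℕ} {r : α → List Bool} (hr : ∀ v, (r v).length = n)
    {P : List Bool} {z : ℕ × List α × List α} {s : Memory} (hz : z.1 < 2 ^ k)
    (h : Represents r P z s) {c : SortCmd} (hc : c.weight < 2 ^ k) :
    Represents r P (SortCmd.step z c) (run (ofSortCmd n k c) s) ∧
      (SortCmd.step z c).1 < 2 ^ k := by
  obtain ⟨p, l, l'⟩ := z
  obtain ⟨f, P, Q, A, B, L, R⟩ := s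
  obtain ⟨rfl, hQ, rfl, rfl, hL, hR⟩ := h
  dsimp only at hQ hL hR hz
  subst hL hR
  cases c with
  | fwd =>
    obtain - | ⟨x, l'⟩ := l'
    · rw [ofSortCmd, run_replicate_of_exec_eq rfl]
      exact ⟨⟨rfl, hQ, rfl, rfl, rfl, rfl⟩, hz⟩
    · rw [ofSortCmd, ← hr x, List.flatMap_cons, run_toLeft]
      exact ⟨⟨rfl, hQ, rfl, rfl, rfl, rfl⟩, hz⟩
  | bwd =>
    obtain - | ⟨x, l⟩ := l
    · rw [ofSortCmd, run_replicate_of_exec_eq rfl]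
      cases l' <;> exact ⟨⟨rfl, hQ, rfl, rfl, rfl, rfl⟩, hz⟩
    · rw [ofSortCmd, ← hr x, ← List.length_reverse, List.flatMap_cons, run_toRight]
      cases l' <;> exact ⟨⟨rfl, hQ, rfl, rfl, rfl, by simp [SortCmd.step]⟩, hz⟩
  | cas w =>
    obtain ⟨Q', h1, h2⟩ := run_subtract hc f P Q [] [] (l.flatMap fun v => (r v).reverse)
      (l'.flatMap r) (hQ ▸ hz)
    rw [SortCmd.weight] at h1 h2
    rw [ofSortCmd, run_append, h1, run_swapRows hr]
    rw [hQ] at h2 ⊢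
    by_cases hw : w ≤ p
    · rw [if_pos hw] at h2
      have : SortCmd.step (p, l, l') (.cas w) = (p - w, l, SortCmd.swapHead l') := by
        cases l' <;> simp [SortCmd.step, hw]
      rw [this]
      refine ⟨⟨rfl, h2, rfl, rfl, rfl, ?_⟩, by dsimp only; omega⟩
      simp [not_lt.2 hw]
    · rw [if_neg hw] at h2
      have : SortCmd.step (p, l, l') (.cas w) = (p, l, l') := by
        cases l' <;> simp [SortCmd.step, hw]
      rw [this]
      refine ⟨⟨rfl, h2, rfl, rfl, rfl, ?_⟩, hz⟩
      simp [not_le.1 hw]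

theorem represents_run_flatMap_ofSortCmd {n k : ℕ} {r : α → List Bool}
    (hr : ∀ v, (r v).length = n) {P : List Bool} {z : ℕ × List α × List α} {s : Memory}
    (hz : z.1 < 2 ^ k) (h : Represents r P z s) {c : List SortCmd}
    (hc : ∀ d ∈ c, d.weight < 2 ^ k) :
    Represents r P (SortCmd.run c z) (run (c.flatMap (ofSortCmd n k)) s) := by
  induction c generalizing z s with
  | nil => exact h
  | cons d c ih =>
    rw [List.flatMap_cons, run_append, SortCmd.run_cons]
    obtain ⟨h1, h2⟩ := represents_run_ofSortCmd hr hz h (hc d (by simp))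
    exact ih h2 h1 fun e he => hc e (by simp [he])

/-- Load the input number `p` and run a sorting program on `p - 1`. -/
def sortRows (n k : ℕ) (c : List SortCmd) : List Instr :=
  List.replicate k load ++ List.replicate k reload ++ subtract k 1 ++ c.flatMap (ofSortCmd n k)

theorem run_sortRows {n k p : ℕ} {r : α → List Bool} (hr : ∀ v, (r v).length = n) (hp : 1 ≤ p)
    (hpk : p < 2 ^ k) {c : List SortCmd} (hc : ∀ d ∈ c, d.weight < 2 ^ k) {l₀ l : List α}
    (hrun : SortCmd.run c (p - 1, [], l₀) = (0, [], l)) (f : Bool) {Q : List Bool}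
    (hQ : bitsVal Q = 0) :
    ∃ f' Q', run (sortRows n k c)
        ⟨f, (Computability.encodeNat p).reverse, Q, [], [], [], l₀.flatMap r⟩ =
      ⟨f', (Computability.encodeNat p).reverse, Q', [], [], [], l.flatMap r⟩ ∧ bitsVal Q' = 0 := by
  set u := Computability.encodeNat p with hu
  obtain ⟨d, hd⟩ := Nat.exists_eq_add_of_le (length_encodeNat_le hpk)
  rw [← hu] at hd
  have h1 : run (List.replicate k load) ⟨f, u.reverse, Q, [], [], [], l₀.flatMap r⟩ =
      ⟨f, [], u ++ Q, u, [], [], l₀.flatMap r⟩ := by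
    have := run_load f [] Q [] [] [] (l₀.flatMap r) u.reverse
    simp only [List.append_nil, List.length_reverse, List.reverse_reverse] at this
    rw [hd, List.replicate_add, run_append, this]
    exact run_replicate_of_exec_eq rfl d
  have h2 : run (List.replicate k reload) ⟨f, [], u ++ Q, u, [], [], l₀.flatMap r⟩ =
      ⟨f, u.reverse, u ++ Q, [], [], [], l₀.flatMap r⟩ := by
    have := run_reload f [] (u ++ Q) [] [] [] (l₀.flatMap r) u
    simp only [List.append_nil] at this
    rw [hd, List.replicate_add, run_append, this]
    exact run_replicate_of_exec_eq rfl d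
  have h3 : bitsVal (u ++ Q) = p := by
    rw [bitsVal_append, hQ, mul_zero, add_zero, hu, bitsVal_encodeNat]
  obtain ⟨Q₁, h4, h5⟩ := run_subtract (k := k) (w := 1) (by omega) f u.reverse (u ++ Q) [] [] []
    (l₀.flatMap r) (h3 ▸ hpk)
  rw [h3, if_pos hp] at h5
  have h6 := represents_run_flatMap_ofSortCmd hr (P := u.reverse) (z := (p - 1, [], l₀))
    (s := ⟨decide (bitsVal (u ++ Q) < 1), u.reverse, Q₁, [], [], [], l₀.flatMap r⟩)
    (by dsimp only; omega) ⟨rfl, h5, rfl, rfl, rfl, rfl⟩ hc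
  rw [hrun] at h6
  rw [sortRows, run_append, run_append, run_append, h1, h2, h4]
  obtain ⟨e1, e2, e3, e4, e5, e6⟩ := h6
  exact ⟨_, _, Memory.ext rfl e1 rfl e3 e4 e5 e6, e2⟩

/-! ### Transposing a matrix -/

/-- Copy a column to `A` from each of `m` rows on `R`, with `i` columns before it and `j` columns
after it. -/
def copyColumn (i j : ℕ) : ℕ → List Instr
  | 0 => []
  | m + 1 => List.replicate i toLeft ++ copy :: List.replicate j toLeft ++ copyColumn i j m

/-- Copy the last `j` of `i + j` columns to `A`, from `m` rows on `R`. -/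
def copyColumns (m : ℕ) : ℕ → ℕ → List Instr
  | _, 0 => []
  | i, j + 1 => copyColumn i j m ++ List.replicate (m * (i + 1 + j)) toRight ++
      copyColumns m (i + 1) j

/-- Transpose the matrix with `m` rows of `n` bits on `R`. -/
def transpose (m n : ℕ) : List Instr :=
  copyColumns m 0 n ++ List.replicate (m * n) drop ++ clear :: List.replicate (m * n) (restore true)

variable {β : Type*}

theorem run_copyColumn (g : α → β → Bool) (rows : List α) (c₁ c₂ : List β) (v : β) (f : Bool)
    (P Q A B L R : List Bool) :
    run (copyColumn c₁.length c₂.length rows.length)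
      ⟨f, P, Q, A, B, L, rows.flatMap (fun u => (c₁ ++ v :: c₂).map (g u)) ++ R⟩ =
    ⟨f, P, Q, (rows.map (g · v)).reverse ++ A, B,
      (rows.flatMap fun u => (c₁ ++ v :: c₂).map (g u)).reverse ++ L, R⟩ := by
  induction rows generalizing A L with
  | nil => rfl
  | cons u rows ih =>
    set T := rows.flatMap (fun u => (c₁ ++ v :: c₂).map (g u)) ++ R with hT
    have h1 := run_toLeft f P Q A B L (g u v :: (c₂.map (g u) ++ T)) (c₁.map (g u))
    have h2 := run_toLeft f P Q (g u v :: A) B (g u v :: ((c₁.map (g u)).reverse ++ L)) T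
      (c₂.map (g u))
    rw [List.length_map] at h1 h2
    have h3 : (u :: rows).flatMap (fun u => (c₁ ++ v :: c₂).map (g u)) ++ R =
        c₁.map (g u) ++ (g u v :: (c₂.map (g u) ++ T)) := by simp [hT]
    rw [h3, List.length_cons, copyColumn, run_append, run_append, h1, run_cons, exec,
      List.head?_cons, List.tail_cons, Option.toList_some, List.singleton_append,
      List.singleton_append, h2, ih]
    simp

theorem length_flatMap_map (g : α → β → Bool) (rows : List α) (c : List β) :
    (rows.flatMap fun u => c.map (g u)).length = rows.length * c.length := by
  induction rows with
  | nil => simp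
  | cons u rows ih => simp only [List.flatMap_cons, List.length_append, ih, List.length_map,
      List.length_cons]; ring

theorem run_copyColumns (g : α → β → Bool) (rows : List α) (c₁ c₂ : List β) (f : Bool)
    (P Q A B : List Bool) :
    run (copyColumns rows.length c₁.length c₂.length)
      ⟨f, P, Q, A, B, [], rows.flatMap fun u => (c₁ ++ c₂).map (g u)⟩ =
    ⟨f, P, Q, (c₂.flatMap fun v => rows.map (g · v)).reverse ++ A, B, [],
      rows.flatMap fun u => (c₁ ++ c₂).map (g u)⟩ := by
  induction c₂ generalizing c₁ A with
  | nil => rfl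
  | cons v c₂ ih =>
    have h1 := run_copyColumn g rows c₁ c₂ v f P Q A B [] []
    set M := rows.flatMap fun u => (c₁ ++ v :: c₂).map (g u) with hM
    have h2 := run_toRight f P Q ((rows.map (g · v)).reverse ++ A) B [] [] M.reverse
    have h3 : M.reverse.length = rows.length * (c₁.length + 1 + c₂.length) := by
      rw [List.length_reverse, hM, length_flatMap_map, List.length_append, List.length_cons]
      ring
    have h4 := ih (c₁ ++ [v]) ((rows.map (g · v)).reverse ++ A)
    rw [List.append_assoc, List.singleton_append, ← hM, List.length_append,
      List.length_singleton] at h4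
    rw [h3] at h2
    simp only [List.append_nil, List.reverse_reverse] at h1 h2
    rw [List.length_cons, copyColumns, run_append, run_append, h1, h2, h4]
    simp

theorem run_transpose (g : α → β → Bool) (rows : List α) (cols : List β) (f : Bool)
    (P Q : List Bool) :
    run (transpose rows.length cols.length)
      ⟨f, P, Q, [], [], [], rows.flatMap fun u => cols.map (g u)⟩ =
    ⟨false, P, Q, [], [], [], cols.flatMap fun v => rows.map (g · v)⟩ := by
  have h1 := run_copyColumns g rows [] cols f P Q [] []
  have h2 := run_drop f P Q (cols.flatMap fun v => rows.map (g · v)).reverse [] [] []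
    (rows.flatMap fun u => cols.map (g u))
  have h3 := run_restore_not false P Q [] [] [] [] (cols.flatMap fun v => rows.map (g · v)).reverse
  rw [length_flatMap_map] at h2
  rw [List.length_reverse, length_flatMap_map (fun v u => g u v), mul_comm] at h3
  simp only [List.append_nil, List.reverse_reverse, List.nil_append, List.length_nil,
    Bool.not_false] at h1 h2 h3
  rw [transpose, run_append, run_append, h1, h2, run_cons, exec, h3]

/-! ### The program for a graph -/

/-- The program that writes the rows `g u` of a matrix, for `u` in `l₀`, and then sorts rows and
columns, by transposing in between. -/
def sortMatrix (g : α → α → Bool) (l₀ : List α) (k : ℕ) (c : List SortCmd) : List Instr :=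
  (l₀.flatMap fun u => l₀.map (g u)).reverse.map push ++ sortRows l₀.length k c ++
    transpose l₀.length l₀.length ++ sortRows l₀.length k c

theorem run_sortMatrix (g : α → α → Bool) {l₀ l : List α} (hl : l.length = l₀.length) {k p : ℕ}
    (hp : 1 ≤ p) (hpk : p < 2 ^ k) {c : List SortCmd} (hc : ∀ d ∈ c, d.weight < 2 ^ k)
    (hrun : SortCmd.run c (p - 1, [], l₀) = (0, [], l)) :
    (run (sortMatrix g l₀ k c) ⟨false, (Computability.encodeNat p).reverse, [], [], [], [], []⟩).R =
      l.flatMap fun v => l.map (g · v) := by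
  set P := (Computability.encodeNat p).reverse with hP
  have h1 := run_push false P [] [] [] [] [] (l₀.flatMap fun u => l₀.map (g u))
  rw [List.append_nil] at h1
  obtain ⟨f₁, Q₁, h2, h3⟩ := run_sortRows (n := l₀.length) (r := fun u => l₀.map (g u))
    (fun _ => List.length_map _) hp hpk hc hrun false (Q := []) rfl
  have h4 := run_transpose g l l₀ f₁ P Q₁
  obtain ⟨f₂, Q₂, h5, h6⟩ := run_sortRows (n := l₀.length) (r := fun v => l.map (g · v))
    (fun _ => (List.length_map _).trans hl) hp hpk hc hrun false h3
  rw [hl] at h4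
  rw [sortMatrix, run_append, run_append, run_append, h1, h2, h4, h5]

end Instr

/-! ### The Turing machine -/

namespace Instr

/-- The instruction with a given four-bit code. -/
def decode : Bool → Bool → Bool → Bool → Instr
  | false, false, false, b => push b
  | false, false, true, b => sub b
  | false, true, false, b => restore b
  | false, true, true, false => toLeft
  | false, true, true, true => toRight
  | true, false, false, false => toA
  | true, false, false, true => toB
  | true, false, true, false => copy
  | true, false, true, true => drop
  | true, true, false, false => clear
  | true, true, false, true => select
  | true, true, true, false => load
  | true, true, true, true => reload

/-- The four-bit code of an instruction. -/
def encode : Instr → List Bool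
  | push b => [false, false, false, b]
  | sub b => [false, false, true, b]
  | restore b => [false, true, false, b]
  | toLeft => [false, true, true, false]
  | toRight => [false, true, true, true]
  | toA => [true, false, false, false]
  | toB => [true, false, false, true]
  | copy => [true, false, true, false]
  | drop => [true, false, true, true]
  | clear => [true, true, false, false]
  | select => [true, true, false, true]
  | load => [true, true, true, false]
  | reload => [true, true, true, true]

/-- The program with a given code. An incomplete last instruction is ignored. -/
def decodeProgram : List Bool → List Instr
  | a :: b :: c :: d :: l => decode a b c d :: decodeProgram l
  | _ => []

theorem decodeProgram_flatMap_encode (c : List Instr) : decodeProgram (c.flatMap encode) = c := by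
  induction c with
  | nil => rfl
  | cons i c ih =>
    rcases i with b | _ | _ | _ | _ | b | _ | _ | _ | b | _ | _ | _ <;>
      simp [encode, decodeProgram, decode, ih]

theorem length_flatMap_encode (c : List Instr) : (c.flatMap encode).length = 4 * c.length := by
  induction c with
  | nil => rfl
  | cons i c ih =>
    have : i.encode.length = 4 := by cases i <;> rfl
    simp only [List.flatMap_cons, List.length_append, ih, this, List.length_cons]
    ring

end Instr

namespace StackMachine

open Turing Turing.TM2.Stmt

/-- The stacks that hold bits: the program and the six stacks of `Memory`. -/
inductive BitStack
  | code | P | Q | A | B | L | R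
  deriving DecidableEq

instance : Fintype BitStack where
  elems := {.code, .P, .Q, .A, .B, .L, .R}
  complete x := by cases x <;> decide

/-- The alphabets of the stacks. The input stack `none` mixes the bits of the program and of the
number. -/
abbrev Alphabet : Option BitStack → Type
  | none => Bool ⊕ Bool
  | some _ => Bool

/-- The labels of the machine: reading the input, fetching the next instruction, executing it, and
emptying the stacks before halting. -/
inductive Label
  | input
  | fetch
  | exec (i : Instr)
  | cleanup
  deriving Fintype

/-- The internal state: the flag, the last symbol read from the input, and four bits read from
other stacks. -/
@[ext]
structure Register where
  flag : Bool
  sym : Option (Bool ⊕ Bool)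
  b₀ : Option Bool
  b₁ : Option Bool
  b₂ : Option Bool
  b₃ : Option Bool

noncomputable instance : Fintype Register :=
  Fintype.ofInjective
    (fun s : Register => (s.flag, s.sym, s.b₀, s.b₁, s.b₂, s.b₃)) fun s t h => by
      simp only [Prod.mk.injEq] at h
      exact Register.ext h.1 h.2.1 h.2.2.1 h.2.2.2.1 h.2.2.2.2.1 h.2.2.2.2.2

/-- The internal state in which only the flag is relevant. -/
def Register.ofFlag (f : Bool) : Register := ⟨f, none, none, none, none, none⟩

/-- Statements of the machine. -/
abbrev Statement := TM2.Stmt Alphabet Label Register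

/-- Forget all registers but the flag and fetch the next instruction. -/
def resume : Statement := load (fun s => .ofFlag s.flag) (goto fun _ => .fetch)

/-- Move a bit from stack `i` to all stacks in `l`, if there is one. -/
def move (i : BitStack) (l : List BitStack) : Statement :=
  pop (some i) (fun s o => { s with b₀ := o }) <|
    branch (fun s => s.b₀.isSome)
      (l.foldr (fun j q => push (some j) (fun s => s.b₀.getD false) q) resume) resume

/-- The statement that executes an instruction. -/
def execStatement : Instr → Statement
  | .push b => push (some .R) (fun _ => b) resume
  | .toLeft => move .R [.L]
  | .toRight => move .L [.R]
  | .toA => move .R [.A]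
  | .toB => move .R [.B]
  | .restore c => branch (fun s => s.flag == c) (move .B [.R]) (move .A [.R])
  | .copy => move .R [.A, .L]
  | .drop => move .R []
  | .clear => load (fun s => { s with flag := false }) resume
  | .sub b =>
    pop (some .Q) (fun s o => { s with b₀ := o }) <|
    push (some .A) (fun s => s.b₀.getD false) <|
    push (some .B) (fun s => s.b₀.getD false ^^ (b ^^ s.flag)) <|
    load (fun s => { s with flag := Bool.carry (!s.b₀.getD false) b s.flag }) resume
  | .select =>
    pop (some .A) (fun s o => { s with b₀ := o }) <|
    pop (some .B) (fun s o => { s with b₁ := o }) <|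
    push (some .Q) (fun s => if s.flag then s.b₀.getD false else s.b₁.getD false) resume
  | .load => move .P [.Q, .A]
  | .reload => move .A [.P]

/-- The program of the machine. -/
def program : Label → Statement
  | .input =>
    pop none (fun s o => { s with sym := o }) <|
    branch (fun s => s.sym.isNone) resume <|
    branch (fun s => s.sym.any Sum.isLeft)
      (push (some .code) (fun s => (s.sym.elim false (Sum.elim id id))) <|
        load (fun s => .ofFlag s.flag) <| goto fun _ => .input)
      (push (some .P) (fun s => (s.sym.elim false (Sum.elim id id))) <|
        load (fun s => .ofFlag s.flag) <| goto fun _ => .input)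
  | .fetch =>
    pop (some .code) (fun s o => { s with b₀ := o }) <|
    pop (some .code) (fun s o => { s with b₁ := o }) <|
    pop (some .code) (fun s o => { s with b₂ := o }) <|
    pop (some .code) (fun s o => { s with b₃ := o }) <|
    branch (fun s => s.b₃.isSome)
      (goto fun s => .exec (Instr.decode (s.b₀.getD false) (s.b₁.getD false) (s.b₂.getD false)
        (s.b₃.getD false)))
      (load (fun _ => .ofFlag false) <| goto fun _ => .cleanup)
  | .exec i => execStatement i
  | .cleanup =>
    [BitStack.P, .Q, .A, .B, .L].foldr
      (fun k q => pop (some k) (fun s o => { s with flag := s.flag || o.isSome }) q) <|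
    branch (fun s => s.flag) (load (fun _ => .ofFlag false) <| goto fun _ => .cleanup) <|
    load (fun _ => .ofFlag false) halt

/-- The contents of the stacks. -/
def contents (inp : List (Bool ⊕ Bool)) (code : List Bool) (m : Memory) :
    ∀ k : Option BitStack, List (Alphabet k)
  | none => inp
  | some .code => code
  | some .P => m.P
  | some .Q => m.Q
  | some .A => m.A
  | some .B => m.B
  | some .L => m.L
  | some .R => m.R

section Update

variable (inp : List (Bool ⊕ Bool)) (f g : Bool) (code P Q A B L R u : List Bool)

/-- The flag is kept in the registers, not on a stack. -/
theorem contents_flag :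
    contents inp code ⟨f, P, Q, A, B, L, R⟩ = contents inp code ⟨g, P, Q, A, B, L, R⟩ := by
  funext k; rcases k with _ | _ | _ <;> rfl

@[simp] theorem update_none (u : List (Bool ⊕ Bool)) (m : Memory) :
    Function.update (contents inp code m) none u = contents u code m := by
  funext k; rcases k with _ | _ | _ <;> rfl

@[simp] theorem update_code (m : Memory) :
    Function.update (contents inp code m) (some .code) u = contents inp u m := by
  funext k; rcases k with _ | _ | _ <;> rfl

@[simp] theorem update_P :
    Function.update (contents inp code ⟨f, P, Q, A, B, L, R⟩) (some .P) u =
      contents inp code ⟨f, u, Q, A, B, L, R⟩ := by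
  funext k; rcases k with _ | _ | _ <;> rfl

@[simp] theorem update_Q :
    Function.update (contents inp code ⟨f, P, Q, A, B, L, R⟩) (some .Q) u =
      contents inp code ⟨f, P, u, A, B, L, R⟩ := by
  funext k; rcases k with _ | _ | _ <;> rfl

@[simp] theorem update_A :
    Function.update (contents inp code ⟨f, P, Q, A, B, L, R⟩) (some .A) u =
      contents inp code ⟨f, P, Q, u, B, L, R⟩ := by
  funext k; rcases k with _ | _ | _ <;> rfl

@[simp] theorem update_B :
    Function.update (contents inp code ⟨f, P, Q, A, B, L, R⟩) (some .B) u =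
      contents inp code ⟨f, P, Q, A, u, L, R⟩ := by
  funext k; rcases k with _ | _ | _ <;> rfl

@[simp] theorem update_L :
    Function.update (contents inp code ⟨f, P, Q, A, B, L, R⟩) (some .L) u =
      contents inp code ⟨f, P, Q, A, B, u, R⟩ := by
  funext k; rcases k with _ | _ | _ <;> rfl

@[simp] theorem update_R :
    Function.update (contents inp code ⟨f, P, Q, A, B, L, R⟩) (some .R) u =
      contents inp code ⟨f, P, Q, A, B, L, u⟩ := by
  funext k; rcases k with _ | _ | _ <;> rfl

end Update

/-- Configurations of the machine. -/
abbrev Config := TM2.Cfg Alphabet Label Register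

theorem step_input (inp : List (Bool ⊕ Bool)) (x : Bool ⊕ Bool) (code P : List Bool) :
    TM2.step program ⟨some .input, .ofFlag false,
        contents (x :: inp) code ⟨false, P, [], [], [], [], []⟩⟩ =
      some ⟨some .input, .ofFlag false, contents inp (x.elim (fun b => [b]) (fun _ => []) ++ code)
        ⟨false, x.elim (fun _ => []) (fun b => [b]) ++ P, [], [], [], [], []⟩⟩ := by
  rcases x with b | b <;> simp [program, contents, Register.ofFlag]

theorem step_input_nil (code : List Bool) (m : Memory) :
    TM2.step program ⟨some .input, .ofFlag false, contents [] code m⟩ =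
      some ⟨some .fetch, .ofFlag false, contents [] code m⟩ := by
  simp [program, contents, Register.ofFlag, resume]

theorem step_exec (i : Instr) (v : Register) (m : Memory) (code : List Bool) (h : v.flag = m.flag) :
    TM2.step program ⟨some (.exec i), v, contents [] code m⟩ =
      some ⟨some .fetch, .ofFlag (Instr.exec m i).flag, contents [] code (Instr.exec m i)⟩ := by
  obtain ⟨f, P, Q, A, B, L, R⟩ := m
  obtain ⟨f', w, b₀, b₁, b₂, b₃⟩ := v
  obtain rfl : f' = f := h
  cases i with
  | push b => simp [program, execStatement, resume, Instr.exec, contents, Register.ofFlag]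
  | toLeft => cases R <;> simp [program, execStatement, move, resume, Instr.exec, contents]
  | toRight => cases L <;> simp [program, execStatement, move, resume, Instr.exec, contents]
  | toA => cases R <;> simp [program, execStatement, move, resume, Instr.exec, contents]
  | toB => cases R <;> simp [program, execStatement, move, resume, Instr.exec, contents]
  | restore c =>
    by_cases hc : f' = c
    · cases B <;> simp [program, execStatement, move, resume, Instr.exec, contents, hc]
    · have hc' : (f' == c) = false := by simpa using hc
      cases A <;> simp [program, execStatement, move, resume, Instr.exec, contents, hc, hc']
  | copy => cases R <;> simp [program, execStatement, move, resume, Instr.exec, contents]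
  | drop => cases R <;> simp [program, execStatement, move, resume, Instr.exec, contents]
  | clear =>
    simp only [program, execStatement, resume, Instr.exec, TM2.step, TM2.stepAux,
      contents_flag [] f' false]
  | sub b =>
    cases Q with
    | nil =>
      simp [program, execStatement, resume, Instr.exec, contents,
        contents_flag [] f' (Bool.carry true b f')]
    | cons x Q =>
      simp [program, execStatement, resume, Instr.exec, contents,
        contents_flag [] f' (Bool.carry (!x) b f')]
  | select => cases A <;> cases B <;> simp [program, execStatement, resume, Instr.exec, contents]
  | load => cases P <;> simp [program, execStatement, move, resume, Instr.exec, contents]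
  | reload => cases A <;> simp [program, execStatement, move, resume, Instr.exec, contents]

theorem step_fetch (a b c d : Bool) (l : List Bool) (m : Memory) :
    ∃ v : Register, v.flag = m.flag ∧
      TM2.step program ⟨some .fetch, .ofFlag m.flag, contents [] (a :: b :: c :: d :: l) m⟩ =
        some ⟨some (.exec (Instr.decode a b c d)), v, contents [] l m⟩ :=
  ⟨⟨m.flag, none, some a, some b, some c, some d⟩, rfl, by
    simp [program, contents, Register.ofFlag]⟩

theorem step_fetch_end {l : List Bool} (hl : l.length < 4) (v : Register) (m : Memory) :
    TM2.step program ⟨some .fetch, v, contents [] l m⟩ =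
      some ⟨some .cleanup, .ofFlag false, contents [] [] m⟩ := by
  match l with
  | [] => simp [program, contents]
  | [a] => simp [program, contents]
  | [a, b] => simp [program, contents]
  | [a, b, c] => simp [program, contents]
  | _ :: _ :: _ :: _ :: _ => simp at hl; omega

/-- A cleanup step removes one entry from every stack but `R`, and halts if there was none. -/
theorem step_cleanup (m : Memory) :
    TM2.step program ⟨some .cleanup, .ofFlag false, contents [] [] m⟩ =
      some ⟨if m.P = [] ∧ m.Q = [] ∧ m.A = [] ∧ m.B = [] ∧ m.L = [] then none else some .cleanup,
        .ofFlag false,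
        contents [] [] ⟨m.flag, m.P.tail, m.Q.tail, m.A.tail, m.B.tail, m.L.tail, m.R⟩⟩ := by
  obtain ⟨f, P, Q, A, B, L, R⟩ := m
  cases P <;> cases Q <;> cases A <;> cases B <;> cases L <;>
    simp [program, contents, Register.ofFlag]

/-! ### Running times -/

/-- The machine gets from one configuration to another in exactly `n` steps. -/
def ReachesIn (n : ℕ) (c c' : Config) : Prop :=
  (flip bind (TM2.step program))^[n] (some c) = some c'

theorem ReachesIn.trans {m n : ℕ} {a b c : Config} (h₁ : ReachesIn m a b) (h₂ : ReachesIn n b c) :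
    ReachesIn (m + n) a c := by
  rw [ReachesIn, add_comm, Function.iterate_add_apply, h₁]
  exact h₂

theorem ReachesIn.of_step {a b : Config} (h : TM2.step program a = some b) : ReachesIn 1 a b := h

theorem ReachesIn.refl (a : Config) : ReachesIn 0 a a := rfl

theorem reachesIn_input_code (a : List Bool) (inp : List (Bool ⊕ Bool)) (code P : List Bool) :
    ReachesIn a.length
      ⟨some .input, .ofFlag false, contents (a.map .inl ++ inp) code ⟨false, P, [], [], [], [], []⟩⟩
      ⟨some .input, .ofFlag false, contents inp (a.reverse ++ code)
        ⟨false, P, [], [], [], [], []⟩⟩ := by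
  induction a generalizing code with
  | nil => exact .refl _
  | cons b a ih =>
    rw [List.length_cons, add_comm, List.reverse_cons, List.append_assoc]
    exact (ReachesIn.of_step (step_input _ _ _ _)).trans (ih (b :: code))

theorem reachesIn_input_number (a : List Bool) (code P : List Bool) :
    ReachesIn a.length
      ⟨some .input, .ofFlag false, contents (a.map .inr) code ⟨false, P, [], [], [], [], []⟩⟩
      ⟨some .input, .ofFlag false,
        contents [] code ⟨false, a.reverse ++ P, [], [], [], [], []⟩⟩ := by
  induction a generalizing P with
  | nil => exact .refl _
  | cons b a ih =>
    rw [List.length_cons, add_comm, List.reverse_cons, List.append_assoc]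
    exact (ReachesIn.of_step (step_input _ _ _ _)).trans (ih (b :: P))

theorem reachesIn_program (code : List Bool) (m : Memory) :
    ReachesIn (2 * (Instr.decodeProgram code).length + 1)
      ⟨some .fetch, .ofFlag m.flag, contents [] code m⟩
      ⟨some .cleanup, .ofFlag false,
        contents [] [] (Instr.run (Instr.decodeProgram code) m)⟩ := by
  induction code using Instr.decodeProgram.induct generalizing m with
  | case1 a b c d l ih =>
    obtain ⟨v, hv, h⟩ := step_fetch a b c d l m
    have h1 := (ReachesIn.of_step h).trans (.of_step (step_exec _ v m l hv))
    have h2 := h1.trans (ih (Instr.exec m (Instr.decode a b c d)))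
    rw [Instr.decodeProgram, Instr.run_cons, List.length_cons]
    convert h2 using 1
    ring
  | case2 l hl =>
    have hlen : l.length < 4 := by
      match l with
      | [] | [_] | [_, _] | [_, _, _] => simp
      | a :: b :: c :: d :: l => exact absurd rfl (hl a b c d l)
    have : Instr.decodeProgram l = [] := by
      match l with
      | [] | [_] | [_, _] | [_, _, _] => rfl
      | a :: b :: c :: d :: l => exact absurd rfl (hl a b c d l)
    rw [this]
    exact .of_step (step_fetch_end hlen _ m)

/-- Every stack other than `R` has at most `n` entries. -/
def _root_.Memory.BoundedBy (m : Memory) (n : ℕ) : Prop :=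
  m.P.length ≤ n ∧ m.Q.length ≤ n ∧ m.A.length ≤ n ∧ m.B.length ≤ n ∧ m.L.length ≤ n

theorem boundedBy_exec {m : Memory} {n : ℕ} (h : m.BoundedBy n) (i : Instr) :
    (Instr.exec m i).BoundedBy (n + 1) := by
  obtain ⟨f, P, Q, A, B, L, R⟩ := m
  obtain ⟨h1, h2, h3, h4, h5⟩ := h
  have key : ∀ l : List Bool, l.head?.toList.length ≤ 1 := fun l => by cases l <;> simp
  have kP := key P
  have kA := key A
  have kB := key B
  have kL := key L
  have kR := key R
  dsimp only at h1 h2 h3 h4 h5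
  cases i <;> (try simp only [Instr.exec]) <;> (try split) <;>
    simp only [Memory.BoundedBy, List.length_cons, List.length_append, List.length_tail] <;>
    omega

theorem boundedBy_run {m : Memory} {n : ℕ} (h : m.BoundedBy n) (c : List Instr) :
    (Instr.run c m).BoundedBy (n + c.length) := by
  induction c generalizing m n with
  | nil => exact h
  | cons i c ih =>
    rw [Instr.run_cons, List.length_cons, show n + (c.length + 1) = n + 1 + c.length by ring]
    exact ih (boundedBy_exec h i)

theorem reachesIn_cleanup {m : Memory} {n : ℕ} (h : m.BoundedBy n) :
    ∃ k ≤ n + 1, ReachesIn k ⟨some .cleanup, .ofFlag false, contents [] [] m⟩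
      ⟨none, .ofFlag false, contents [] [] ⟨m.flag, [], [], [], [], [], m.R⟩⟩ := by
  induction n generalizing m with
  | zero =>
    refine ⟨1, le_rfl, ReachesIn.of_step ?_⟩
    obtain ⟨f, P, Q, A, B, L, R⟩ := m
    obtain ⟨h1, h2, h3, h4, h5⟩ := h
    simp only [Nat.le_zero, List.length_eq_zero_iff] at h1 h2 h3 h4 h5
    subst h1 h2 h3 h4 h5
    rw [step_cleanup]
    simp
  | succ n ih =>
    have hs := step_cleanup m
    split_ifs at hs with hm
    · obtain ⟨f, P, Q, A, B, L, R⟩ := m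
      obtain ⟨h1, h2, h3, h4, h5⟩ := hm
      dsimp only at h1 h2 h3 h4 h5
      subst h1 h2 h3 h4 h5
      exact ⟨1, by omega, .of_step hs⟩
    · obtain ⟨h1, h2, h3, h4, h5⟩ := h
      obtain ⟨k, hk, h⟩ := @ih ⟨m.flag, m.P.tail, m.Q.tail, m.A.tail, m.B.tail, m.L.tail, m.R⟩
        ⟨by simp; omega, by simp; omega, by simp; omega, by simp; omega, by simp; omega⟩
      exact ⟨1 + k, by omega, (ReachesIn.of_step hs).trans h⟩

/-- The stack machine as a Turing machine. The output is left on `R`. -/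
noncomputable def machine : FinTM2 where
  K := Option BitStack
  k₀ := none
  k₁ := some .R
  Γ := Alphabet
  Λ := Label
  main := .input
  σ := Register
  initialState := .ofFlag false
  Γk₀Fin := inferInstanceAs (Fintype (Bool ⊕ Bool))
  m := program

/-- The memory in which the program is started. -/
def initialMemory (p : ℕ) : Memory :=
  ⟨false, (Computability.encodeNat p).reverse, [], [], [], [], []⟩

/-- The decoder: the first argument is the reversed code of a program, which is run on the second
argument. The code is reversed because pushing it bit by bit to a stack reverses it again. -/
def decoder (x : List Bool × ℕ) : List Bool :=
  (Instr.run (Instr.decodeProgram x.1.reverse) (initialMemory x.2)).R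

theorem length_decodeProgram_le (l : List Bool) : (Instr.decodeProgram l).length ≤ l.length := by
  induction l using Instr.decodeProgram.induct with
  | case1 a b c d l ih => simp only [Instr.decodeProgram, List.length_cons]; omega
  | case2 l hl => simp [Instr.decodeProgram]

theorem exists_reachesIn_decoder (a : List Bool) (p : ℕ) :
    ∃ n ≤ 5 * (a.length + (Computability.encodeNat p).length) + 3, ∃ f, ReachesIn n
      ⟨some .input, .ofFlag false, contents (a.map .inl ++ (Computability.encodeNat p).map .inr) []
        ⟨false, [], [], [], [], [], []⟩⟩
      ⟨none, .ofFlag false, contents [] [] ⟨f, [], [], [], [], [], decoder (a, p)⟩⟩ := by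
  set u := Computability.encodeNat p with hu
  set c := Instr.decodeProgram a.reverse with hc
  have h1 := reachesIn_input_code a (u.map .inr) [] []
  have h2 := reachesIn_input_number u a.reverse []
  simp only [List.append_nil] at h1 h2
  have h3 := reachesIn_program a.reverse (initialMemory p)
  rw [← hc] at h3
  have hb : (initialMemory p).BoundedBy (a.length + u.length) := by
    simp [Memory.BoundedBy, initialMemory, hu]
  obtain ⟨k, hk, h4⟩ := reachesIn_cleanup (boundedBy_run hb c)
  have hlen : c.length ≤ a.length := by
    simpa using length_decodeProgram_le a.reverse
  exact ⟨_, by omega, _,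
    (((h1.trans h2).trans (.of_step (step_input_nil _ _))).trans h3).trans h4⟩

theorem isPolyTimeDecoder_decoder : IsPolyTimeDecoder decoder := by
  refine ⟨⟨⟨machine, Equiv.refl (Bool ⊕ Bool), Equiv.refl Bool⟩, 5 * Polynomial.X + 3, fun x => ?_⟩⟩
  obtain ⟨a, p⟩ := x
  have h := exists_reachesIn_decoder a p
  choose n hn f h using h
  refine ⟨⟨n, ?_⟩, ?_⟩
  · have e1 : initList machine (List.map (Equiv.refl (Bool ⊕ Bool)).invFun
        ((Computability.encodingProd (Computability.encodingList Bool)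
          Computability.encodingNatBool).encode (a, p))) =
        (⟨some .input, .ofFlag false,
          contents (a.map .inl ++ (Computability.encodeNat p).map .inr) []
            ⟨false, [], [], [], [], [], []⟩⟩ : Config) := by
      unfold initList
      congr 1
      funext k
      rcases k with _ | k
      · simp [machine, contents, Computability.encodingProd, Computability.encodingList,
          Computability.encodingNatBool]
        rfl
      · cases k <;> rfl
    have e2 : haltList machine (List.map (Equiv.refl Bool).invFun
        ((Computability.encodingList Bool).encode (decoder (a, p)))) =
        (⟨none, .ofFlag false, contents [] [] ⟨f, [], [], [], [], [], decoder (a, p)⟩⟩ :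
          Config) := by
      unfold haltList
      congr 1
      funext k
      rcases k with _ | k
      · rfl
      · cases k with
        | R =>
          simp [machine, contents, Computability.encodingList]
          rfl
        | _ => rfl
    rw [Option.map_some]
    refine Eq.trans ?_ (Eq.trans h ?_)
    · exact congrArg (fun c => (flip bind (TM2.step program))^[n] (some c)) e1
    · exact congrArg some e2.symm
  · simpa [Computability.encodingProd, Computability.encodingList,
      Computability.encodingNatBool] using hn

end StackMachine

/-! ### Lengths of programs -/

namespace Instr

theorem length_ofSortCmd_le (n k : ℕ) (c : SortCmd) :
    (ofSortCmd n k c).length ≤ 2 * k + 1 + 4 * n := by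
  cases c with
  | fwd => simp only [ofSortCmd, List.length_replicate]; omega
  | bwd => simp only [ofSortCmd, List.length_replicate]; omega
  | cas w =>
    simp only [ofSortCmd, subtract, swapRows, List.length_append, List.length_cons,
      List.length_map, length_toBits, List.length_replicate]
    omega

theorem length_sortRows_le (n k : ℕ) (c : List SortCmd) :
    (sortRows n k c).length ≤ 4 * k + 1 + c.length * (2 * k + 1 + 4 * n) := by
  have h : (c.flatMap (ofSortCmd n k)).length ≤ c.length * (2 * k + 1 + 4 * n) := by
    induction c with
    | nil => simp
    | cons d c ih =>
      have := length_ofSortCmd_le n k d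
      simp only [List.flatMap_cons, List.length_append, List.length_cons, add_mul, one_mul] at ih ⊢
      omega
  simp only [sortRows, subtract, List.length_append, List.length_cons, List.length_map,
    length_toBits, List.length_replicate]
  omega

theorem length_copyColumn (i j m : ℕ) : (copyColumn i j m).length = m * (i + 1 + j) := by
  induction m with
  | zero => simp [copyColumn]
  | succ m ih =>
    simp only [copyColumn, List.length_append, List.length_cons, List.length_replicate, ih]
    ring

theorem length_copyColumns (m i j : ℕ) :
    (copyColumns m i j).length = j * (2 * m * (i + j)) := by
  induction j generalizing i with
  | zero => simp [copyColumns]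
  | succ j ih =>
    simp only [copyColumns, List.length_append, List.length_replicate, ih, length_copyColumn]
    ring

theorem length_sortMatrix_le {α : Type*} (g : α → α → Bool) (l₀ : List α) (k : ℕ)
    (c : List SortCmd) :
    (sortMatrix g l₀ k c).length ≤ 2 * l₀.length ^ 3 + 3 * l₀.length ^ 2 + 8 * k + 3 +
      2 * (c.length * (2 * k + 1 + 4 * l₀.length)) := by
  have h1 := length_sortRows_le l₀.length k c
  simp only [sortMatrix, transpose, List.length_append, List.length_cons, List.length_map,
    List.length_reverse, List.length_replicate, length_flatMap_map, length_copyColumns]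
  ring_nf at h1 ⊢
  omega

end Instr

/-! ### The automorphism group -/

section Graph

open Equiv

variable {V : Type*}

/-- The automorphisms of a graph, as a group of permutations of its vertices. -/
def SimpleGraph.autSubgroup (G : SimpleGraph V) : Subgroup (Perm V) where
  carrier := {g | ∀ u v, G.Adj (g u) (g v) ↔ G.Adj u v}
  mul_mem' := fun ha hb u v => (ha _ _).trans (hb u v)
  one_mem' := fun _ _ => Iff.rfl
  inv_mem' := fun {g} hg u v => by
    have := hg (g⁻¹ u) (g⁻¹ v)
    simpa using this.symm

theorem SimpleGraph.card_autSubgroup (G : SimpleGraph V) :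
    Nat.card G.autSubgroup = Nat.card (G ≃g G) :=
  Nat.card_congr
    { toFun := fun g => ⟨g.1, g.2 _ _⟩
      invFun := fun e => ⟨e.toEquiv, fun _ _ => e.map_rel_iff⟩
      left_inv := fun _ => rfl
      right_inv := fun _ => rfl }

/-- For every graph `G` there is a sorting program of quadratic length that reaches, up to
automorphisms of `G`, every arrangement of the vertices, from at most `n! / |Aut G|` numbers. -/
theorem SimpleGraph.exists_sortProgram {n : ℕ} (G : SimpleGraph (Fin n)) :
    ∃ (l₀ : List (Fin n)) (c : List SortCmd) (N : ℕ), l₀.length = n ∧ c.length ≤ 4 * n ^ 2 ∧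
      (∀ d ∈ c, d.weight ≤ N) ∧ N ≤ n.factorial / Nat.card (G ≃g G) ∧
      ∀ π : Perm (Fin n), ∃ g ∈ G.autSubgroup, ∃ p < N,
        SortCmd.run c (p, [], l₀) = (0, [], (List.finRange n).map (g * π⁻¹ : Perm (Fin n))) := by
  obtain ⟨l₀, c, N, h1, h2, h3, h4, h5, h6⟩ :=
    _root_.exists_sortProgram Finset.univ G.autSubgroup fun _ _ _ _ => Finset.mem_univ _
  rw [Finset.card_univ, Fintype.card_fin] at h3 h5
  refine ⟨l₀, c, N, ?_, h3, h4, ?_, fun π => ?_⟩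
  · rw [← List.toFinset_card_of_nodup h1, h2, Finset.card_univ, Fintype.card_fin]
  · have hfix : G.autSubgroup ⊓ fixingSubgroup (Perm (Fin n))
        ((Finset.univ : Finset (Fin n)) : Set (Fin n)) = ⊥ := by
      rw [eq_bot_iff]
      intro g hg
      rw [Subgroup.mem_bot]
      ext v
      rw [show g v = v from (mem_fixingSubgroup_iff _).1 hg.2 v (by simp)]
      rfl
    rw [hfix, Subgroup.card_bot, mul_one, G.card_autSubgroup] at h5
    have : Finite (G ≃g G) := Finite.of_injective (fun e : G ≃g G => (e : Fin n → Fin n))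
      DFunLike.coe_injective
    have : 0 < Nat.card (G ≃g G) := Nat.card_pos
    exact (Nat.le_div_iff_mul_le this).2 h5
  · obtain ⟨g, hg, p, hp, hrun⟩ := h6 ((List.finRange n).map (π⁻¹ : Perm (Fin n)))
      ((List.nodup_finRange n).map (Equiv.injective _)) (by
        ext v
        simp only [List.mem_toFinset, List.mem_map, List.mem_finRange, true_and, Finset.mem_univ,
          iff_true]
        exact ⟨π v, by simp⟩)
    refine ⟨g, hg, p, hp, ?_⟩
    have := hrun [] []
    rw [List.append_nil, List.append_nil, List.map_map] at this
    exact this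

/-- The rows of `π(G)` belong to the vertices `π⁻¹ 0, π⁻¹ 1, …` of `G`, and replacing these by their
images under an automorphism of `G` does not change the matrix. The right-hand side is the
transposed matrix, which is the same because adjacency is symmetric. -/
theorem adjacencyString_map {n : ℕ} (G : SimpleGraph (Fin n)) [DecidableRel G.Adj]
    (π : Perm (Fin n)) {g : Perm (Fin n)} (hg : g ∈ G.autSubgroup) {l : List (Fin n)}
    (hl : l = (List.finRange n).map (g * π⁻¹ : Perm (Fin n))) :
    adjacencyString (G.map π) = l.flatMap fun v => l.map fun u => decide (G.Adj u v) := by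
  have key : ∀ i j, (G.map π).Adj i j ↔ G.Adj ((g * π⁻¹) j) ((g * π⁻¹) i) := by
    intro i j
    rw [Perm.mul_apply, Perm.mul_apply, hg, G.adj_comm]
    rw [show (G.map π) = G.map (π.toEmbedding : Fin n → Fin n) from rfl, SimpleGraph.map_adj]
    constructor
    · rintro ⟨u, v, h, rfl, rfl⟩
      simpa using h
    · intro h
      exact ⟨_, _, h, by simp, by simp⟩
  subst hl
  simp only [adjacencyString, key, List.flatMap_map, List.map_map]
  congr 1

end Graph

theorem factorial_lt_two_pow (n : ℕ) : n.factorial < 2 ^ (n * (Nat.log 2 n + 1) + 1) := by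
  calc n.factorial ≤ n ^ n := Nat.factorial_le_pow n
    _ ≤ (2 ^ (Nat.log 2 n + 1)) ^ n :=
      Nat.pow_le_pow_left (Nat.lt_pow_succ_log_self (by norm_num) n).le n
    _ = 2 ^ (n * (Nat.log 2 n + 1)) := by rw [← pow_mul, mul_comm]
    _ < 2 ^ (n * (Nat.log 2 n + 1) + 1) := Nat.pow_lt_pow_right (by norm_num) (Nat.lt_succ_self _)

theorem natLog_two_le_two_mul_log {n : ℕ} (hn : 2 ≤ n) : (Nat.log 2 n : ℝ) ≤ 2 * Real.log n := by
  have h1 : ((2 ^ Nat.log 2 n : ℕ) : ℝ) ≤ n := by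
    exact_mod_cast Nat.pow_log_le_self 2 (by omega)
  have h2 := Real.log_le_log (by positivity) h1
  rw [Nat.cast_pow, Real.log_pow, Nat.cast_ofNat] at h2
  have h3 := Real.log_two_gt_d9
  have h4 : (0 : ℝ) ≤ Nat.log 2 n := Nat.cast_nonneg _
  nlinarith

theorem mainTheorem4 :
    ∃ D : List Bool × ℕ → List Bool, IsPolyTimeDecoder D ∧
      ∃ c : ℝ, ∀ (n : ℕ) (G : SimpleGraph (Fin n)), ∃ aux : List Bool,
        (2 ≤ n → (aux.length : ℝ) ≤ c * ((n : ℝ) ^ 3 * Real.log n)) ∧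
        ∀ π : Equiv.Perm (Fin n), ∃ p ∈ Finset.Icc 1 (n.factorial / Nat.card (G ≃g G)),
          D (aux, p) = adjacencyString (G.map π) := by
  classical
  refine ⟨StackMachine.decoder, StackMachine.isPolyTimeDecoder_decoder, 960, fun n G => ?_⟩
  obtain ⟨l₀, c, N, hl₀, hc, hw, hN, hrun⟩ := G.exists_sortProgram
  -- the number of binary digits that suffices for all weights and for `p`
  set k := n * (Nat.log 2 n + 1) + 1 with hk
  have hNk : N < 2 ^ k :=
    (hN.trans (Nat.div_le_self _ _)).trans_lt (factorial_lt_two_pow n)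
  set prog := Instr.sortMatrix (fun u v => decide (G.Adj u v)) l₀ k c with hprog
  refine ⟨(prog.flatMap Instr.encode).reverse, fun hn => ?_, fun π => ?_⟩
  · have h1 := Instr.length_sortMatrix_le (fun u v => decide (G.Adj u v)) l₀ k c
    rw [← hprog, hl₀] at h1
    rw [List.length_reverse, Instr.length_flatMap_encode]
    -- The program has at most `120 * n ^ 3 * t` instructions of four bits each, and
    -- `t ≤ 2 * log n`, which gives the constant `960`.
    set t := Nat.log 2 n with ht
    have ht1 : 1 ≤ t := Nat.log_pos (by norm_num) hn
    have h2 : prog.length ≤ 120 * (n ^ 3 * t) := by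
      have e0 : 1 ≤ n ^ 3 * t := Nat.mul_pos (by positivity) ht1
      have e1 : n ^ 3 ≤ n ^ 3 * t := Nat.le_mul_of_pos_right _ ht1
      have e2 : n ^ 2 ≤ n ^ 3 := Nat.pow_le_pow_right (by omega) (by norm_num)
      have e3 : n ≤ n * t := Nat.le_mul_of_pos_right _ ht1
      have e4 : n * t ≤ n ^ 3 * t := Nat.mul_le_mul_right _ (Nat.le_self_pow (by norm_num) n)
      have e5 : k ≤ 3 * (n * t) := by
        rw [hk, mul_add, mul_one]
        omega
      have e6 : c.length * (2 * k + 1 + 4 * n) ≤ 4 * n ^ 2 * (11 * (n * t)) :=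
        Nat.mul_le_mul hc (by omega)
      have e7 : 4 * n ^ 2 * (11 * (n * t)) = 44 * (n ^ 3 * t) := by ring
      omega
    have h3 := natLog_two_le_two_mul_log hn
    have h4 : (prog.length : ℝ) ≤ 120 * ((n : ℝ) ^ 3 * t) := by exact_mod_cast h2
    have h5 : (n : ℝ) ^ 3 * t ≤ (n : ℝ) ^ 3 * (2 * Real.log n) :=
      mul_le_mul_of_nonneg_left h3 (by positivity)
    push_cast
    linarith
  · obtain ⟨g, hg, p, hp, hrun⟩ := hrun π
    refine ⟨p + 1, Finset.mem_Icc.2 ⟨by omega, by omega⟩, ?_⟩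
    rw [adjacencyString_map G π hg rfl, StackMachine.decoder, List.reverse_reverse,
      Instr.decodeProgram_flatMap_encode]
    exact Instr.run_sortMatrix _ (by rw [hl₀]; simp) (by omega) (by omega)
      (fun d hd => (hw d hd).trans_lt hNk) hrun
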